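/- Let $n\ge 1$, $m\ge 0$, and $a=(a_1,\dots,a_n)\in\mathbb{R}_{>0}^n$. Let $\Lambda_n$ be the set of partitions $\lambda=(\lambda_1\ge\lambda_2\ge\cdots\ge 0)$ with at most $n$ non-zero parts, and write $|\lambda|=\sum_i\lambda_i$; let $e_i$ be the $i$-th unit vector. For $0<q<1$ and $\lambda,\mu\in\Lambda_n$ put $$L_n(\lambda,\mu)=\begin{cases}u^+_{n,i}(\lambda)&\text{if }\mu=\lambda+e_i,\ 1\le i\le n,\\ u^-_{n,i}(\lambda)&\text{if }\mu=\lambda-e_i,\ 1\le i\le n,\\ 0&\text{otherwise,}\end{cases}$$ where $u^+_{n,1}(\lambda)=1$, $u^+_{n,i}(\lambda)=1-q^{\lambda_{i-1}-\lambda_i}$ for $1<i\le n$, $u^-_{n,i}(\lambda)=1-q^{\lambda_i-\lambda_{i+1}}$ for $1\le i<n$, and $u^-_{n,n}(\lambda)=1-q^{\lambda_n}$. Let $\mathcal{O}_m(n)$ be the set of oscillating tableaux of length $m$ in $\Lambda_n$, that is, sequences $f=(f^0,\dots,f^m)$ in $\Lambda_n$ with $f^0=\emptyset$ such that consecutive partitions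 differ by exactly one box (added or removed). For $\lambda\in\Lambda_n$ let $$Q^\lambda_m(n;q)=\sum_{f\in\mathcal{O}_m(n),\ f^m=\lambda}\ \prod_{i=1}^m L_n(f^{i-1},f^i),\qquad Q^\lambda_m(n)=\#\{f\in\mathcal{O}_m(n): f^m=\lambda\}.$$ For partitions write $\mu\preceq\lambda$ if $\lambda_1\ge\mu_1\ge\lambda_2\ge\mu_2\ge\cdots$. Let $\mathbb{K}^{2n}[\lambda]$ be the set of symplectic Gelfand–Tsetlin patterns of shape $\lambda$: sequences $Z=(z^1\preceq z^2\preceq\cdots\preceq z^{2n}=\lambda)$ with $z^{2k-1},z^{2k}\in\Lambda_k$ for $1\le k\le n$; put $z^0=\emptyset$. With $(q;q)_N=\prod_{k=1}^N(1-q^k)$ and $\binom{N}{k}_q=\frac{(q;q)_N}{(q;q)_k(q;q)_{N-k}}$, let $$P^{(n)}_\lambda(a;q)=\sum_{Z\in\mathbb{K}^{2n}[\lambda]}\ \prod_{i=1}^n a_i^{2|z^{2i-1}|-|z^{2i}|-|z^{2i-2}|}\ \prod_{k=1}^n\left[\binom{z^{2k}_k}{z^{2k}_k-z^{2k-1}_k}_q\prod_{i=1}^{k-1}\binom{z^{2k-1}_i-z^{2k-1}_{i+1}}{z^{2k-1}_i-z^{2k-2}_i}_q\binom{z^{2k}_i-z^{2k}_{i+1}}{z^{2k}_i-z^{2k-1}_i}_q\right].$$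 Let $Sp^{(n)}_\lambda(a)=\sum_T\prod_{k=1}^n a_k^{\#\{k\text{'s in }T\}-\#\{\bar k\text{'s in }T\}}$ be the symplectic Schur function, where $T$ runs over the fillings of the Young diagram of $\lambda$ with letters $1<\bar 1<2<\bar 2<\cdots<n<\bar n$ that are weakly increasing along rows, strictly increasing down columns, and have no entry smaller than $i$ in row $i$. Then for every $q\in(0,1)$ $$(a_1+a_1^{-1}+\cdots+a_n+a_n^{-1})^m=\sum_{\lambda\in\Lambda_n}Q^\lambda_m(n;q)\,P^{(n)}_\lambda(a;q).$$ Moreover, for every $\lambda\in\Lambda_n$, as $q\to 0^+$ one has $Q^\lambda_m(n;q)\to Q^\lambda_m(n)$ and $P^{(n)}_\lambda(a;q)\to Sp^{(n)}_\lambda(a)$, and $$(a_1+a_1^{-1}+\cdots+a_n+a_n^{-1})^m=\sum_{\lambda\in\Lambda_n}Q^\lambda_m(n)\,Sp^{(n)}_\lambda(a).$$ -/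

import Mathlib

open Filter Topology

namespace QBerele

/-- `Lam n` is the set of partitions of length at most `n`. A partition is a weakly decreasing
sequence of natural numbers with finitely many non-zero terms; rows are indexed from `0`, so the
part `λ_{i+1}` is `l i`. -/
def Lam (n : ℕ) : Set (ℕ →₀ ℕ) :=
  {l | Antitone l ∧ l.support.card ≤ n}

/-- The unit vector `e_{i+1}`. -/
noncomputable def e (i : ℕ) : ℕ →₀ ℕ := Finsupp.single i 1

/-! ### Oscillating tableaux -/

/-- Two partitions differ by exactly one box. -/
def DifferByBox (l u : ℕ →₀ ℕ) : Prop :=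
  ∃ j, u = l + e j ∨ l = u + e j

/-- Oscillating tableaux `(f^0, …, f^m)` of length `m`, all of whose partitions lie in `Lam n`,
that start at the empty partition and have shape `l`. -/
def oscSet (n m : ℕ) (l : ℕ →₀ ℕ) : Set (Fin (m + 1) → ℕ →₀ ℕ) :=
  {f | f 0 = 0 ∧ (∀ i : Fin m, DifferByBox (f i.castSucc) (f i.succ)) ∧
    (∀ i, f i ∈ Lam n) ∧ f (Fin.last m) = l}

theorem Lam.eq_zero {n : ℕ} {l : ℕ →₀ ℕ} (hl : l ∈ Lam n) {i : ℕ} (hi : n ≤ i) : l i = 0 := by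
  by_contra h
  have hsub : Finset.range (i + 1) ⊆ l.support := by
    intro j hj
    have hj' : j ≤ i := by simpa [Nat.lt_succ_iff] using hj
    have := hl.1 hj'
    rw [Finsupp.mem_support_iff]
    omega
  have hc := Finset.card_le_card hsub
  have h2 := hl.2
  simp only [Finset.card_range] at hc
  omega

theorem Lam.finite_bounded (n b : ℕ) : {l : ℕ →₀ ℕ | l ∈ Lam n ∧ l 0 ≤ b}.Finite := by
  refine (Set.finite_Icc (0 : ℕ →₀ ℕ)
    (Finsupp.indicator (Finset.range n) (fun _ _ => b))).subset ?_
  rintro l ⟨hl, hb⟩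
  refine ⟨zero_le, fun i => ?_⟩
  by_cases hi : i < n
  · have := hl.1 (Nat.zero_le i)
    simp [Finsupp.indicator_apply, hi]
    omega
  · simp [Lam.eq_zero hl (not_lt.mp hi)]

theorem oscSet_finite (n m : ℕ) (l : ℕ →₀ ℕ) : (oscSet n m l).Finite := by
  refine (Set.Finite.pi' (fun _ : Fin (m + 1) => Lam.finite_bounded n m)).subset ?_
  rintro f ⟨h0, hstep, hlam, -⟩ i
  refine ⟨hlam i, ?_⟩
  have key : ∀ i : Fin (m + 1), f i 0 ≤ i := by
    intro i
    induction i using Fin.induction with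
    | zero => simp [h0]
    | succ i ih =>
      obtain ⟨j, h | h⟩ := hstep i
      · rw [h]
        have : e j 0 ≤ 1 := by
          unfold e; rw [Finsupp.single_apply]; split_ifs <;> omega
        simp only [Finsupp.add_apply, Fin.val_succ, Fin.val_castSucc] at ih ⊢
        omega
      · rw [h] at ih
        simp only [Finsupp.add_apply, Fin.val_succ, Fin.val_castSucc] at ih ⊢
        omega
  have := key i
  omega

/-- The number of oscillating tableaux of length `m` and shape `l` with partitions in `Lam n`. -/
noncomputable def oscCount (n m : ℕ) (l : ℕ →₀ ℕ) : ℕ :=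
  (oscSet_finite n m l).toFinset.card

/-! ### The weights -/

/-- `u^+_{n,i+1}`. -/
noncomputable def uPlus (q : ℝ) (l : ℕ →₀ ℕ) (i : ℕ) : ℝ :=
  if i = 0 then 1 else 1 - q ^ (l (i - 1) - l i)

/-- `u^-_{n,i+1}`. -/
noncomputable def uMinus (n : ℕ) (q : ℝ) (l : ℕ →₀ ℕ) (i : ℕ) : ℝ :=
  if i + 1 < n then 1 - q ^ (l i - l (i + 1)) else 1 - q ^ l i

/-- The kernel `L_n(l, u)`. At most one of the conditions `u = l + e_i`, `u = l - e_i`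
(`1 ≤ i ≤ n`) holds, so the sum has at most one non-zero term. -/
noncomputable def kernelL (n : ℕ) (q : ℝ) (l u : ℕ →₀ ℕ) : ℝ :=
  ∑ i ∈ Finset.range n,
    ((if u = l + e i then uPlus q l i else 0) + (if l = u + e i then uMinus n q l i else 0))

/-- `Q^λ_m(n;q)`. -/
noncomputable def oscWeight (n m : ℕ) (q : ℝ) (l : ℕ →₀ ℕ) : ℝ :=
  ∑ f ∈ (oscSet_finite n m l).toFinset,
    ∏ i : Fin m, kernelL n q (f i.castSucc) (f i.succ)

/-! ### The `q`-binomial coefficients -/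

/-- `(q;q)_N = ∏_{k=1}^N (1 - q^k)`. -/
noncomputable def qPoch (q : ℝ) (N : ℕ) : ℝ := ∏ k ∈ Finset.Icc 1 N, (1 - q ^ k)

/-- The `q`-factorial. -/
noncomputable def qFact (q : ℝ) (N : ℕ) : ℝ := qPoch q N / (1 - q) ^ N

/-- The `q`-binomial coefficient, for `k ≤ N`. -/
noncomputable def qBinom (q : ℝ) (N k : ℕ) : ℝ := qFact q N / (qFact q k * qFact q (N - k))

/-! ### Symplectic Gelfand-Tsetlin patterns -/

/-- `u ≼ l`: the partitions interlace, `l_1 ≥ u_1 ≥ l_2 ≥ u_2 ≥ …`. -/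
def Interlaces (u l : ℕ →₀ ℕ) : Prop := ∀ i, u i ≤ l i ∧ l (i + 1) ≤ u i

/-- Symplectic Gelfand-Tsetlin patterns `(z^1, …, z^{2n})` of shape `z^{2n} = l`: the levels
`z^{2k-1}` and `z^{2k}` are partitions of length at most `k`, and consecutive levels interlace.
The empty level `z^0` is added, and levels beyond `2n` are set to zero. -/
def gtSet (n : ℕ) (l : ℕ →₀ ℕ) : Set (ℕ → ℕ →₀ ℕ) :=
  {Z | (∀ k, 1 ≤ k → k ≤ 2 * n → Z k ∈ Lam ((k + 1) / 2)) ∧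
    (∀ k, 1 ≤ k → k < 2 * n → Interlaces (Z k) (Z (k + 1))) ∧
    Z 0 = 0 ∧ (∀ k, 2 * n < k → Z k = 0) ∧ Z (2 * n) = l}

theorem gtSet_finite (n : ℕ) (l : ℕ →₀ ℕ) : (gtSet n l).Finite := by
  have hpi : {g : Fin (2 * n + 1) → ℕ →₀ ℕ | ∀ k, g k ∈ Set.Icc 0 l}.Finite :=
    Set.Finite.pi' (fun _ => Set.finite_Icc 0 l)
  refine (hpi.image (fun g k => if h : k < 2 * n + 1 then g ⟨k, h⟩ else 0)).subset ?_
  rintro Z ⟨-, hint, h0, hbig, hl⟩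
  have key : ∀ d k, 1 ≤ k → k + d = 2 * n → Z k ≤ l := by
    intro d
    induction d with
    | zero =>
      intro k _ hk
      have : k = 2 * n := by omega
      rw [this, hl]
    | succ d ih =>
      intro k hk1 hk
      refine le_trans (fun i => (hint k hk1 (by omega) i).1) (ih (k + 1) (by omega) (by omega))
  refine ⟨fun k => Z k, fun k => ⟨zero_le, ?_⟩, ?_⟩
  · by_cases hk : (k : ℕ) = 0
    · simp only [hk, h0]; exact zero_le
    · exact key (2 * n - k) k (by omega) (by omega)
  · funext k
    by_cases hk : k < 2 * n + 1
    · simp [hk]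
    · simp [hk, hbig k (by omega)]

/-- `a^Z = ∏_{i=1}^n a_i^{2|z^{2i-1}| - |z^{2i}| - |z^{2i-2}|}`. -/
noncomputable def gtMonomial (n : ℕ) (a : Fin n → ℝ) (Z : ℕ → ℕ →₀ ℕ) : ℝ :=
  ∏ i : Fin n, a i ^ (2 * ((Z (2 * i + 1)).degree : ℤ) - ((Z (2 * i + 2)).degree : ℤ)
    - ((Z (2 * i)).degree : ℤ))

/-- The weight `κ_n(Z)`; the index `k` below is the usual `k - 1`. -/
noncomputable def kappa (n : ℕ) (q : ℝ) (Z : ℕ → ℕ →₀ ℕ) : ℝ :=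
  ∏ k ∈ Finset.range n,
    ((∏ i ∈ Finset.range k,
      (qBinom q (Z (2 * k + 1) i - Z (2 * k + 1) (i + 1)) (Z (2 * k + 1) i - Z (2 * k) i) *
       qBinom q (Z (2 * k + 2) i - Z (2 * k + 2) (i + 1))
        (Z (2 * k + 2) i - Z (2 * k + 1) i))) *
      qBinom q (Z (2 * k + 2) k) (Z (2 * k + 2) k - Z (2 * k + 1) k))

/-- `P^{(n)}_λ(a;q)`. -/
noncomputable def qSymp (n : ℕ) (a : Fin n → ℝ) (q : ℝ) (l : ℕ →₀ ℕ) : ℝ :=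
  ∑ Z ∈ (gtSet_finite n l).toFinset, gtMonomial n a Z * kappa n q Z

/-! ### Symplectic Schur functions -/

/-- The Young diagram of a partition. -/
def diagram {n : ℕ} (l : Lam n) : YoungDiagram where
  cells := l.1.support.biUnion fun i => (Finset.range (l.1 i)).image fun j => (i, j)
  isLowerSet := by
    rintro ⟨i, j⟩ ⟨i', j'⟩ ⟨hi, hj⟩ h
    simp only [Finset.coe_biUnion, Set.mem_iUnion, Finset.mem_coe, Finsupp.mem_support_iff,
      Finset.mem_image, Finset.mem_range, Prod.mk.injEq] at h ⊢
    obtain ⟨r, hr, c, hc, rfl, rfl⟩ := h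
    have h1 := l.2.1 hi
    have h2 : j' ≤ c := hj
    simp only at h1
    exact ⟨i', by omega, j', by omega, rfl, rfl⟩

theorem mem_diagram {n : ℕ} (l : Lam n) (i j : ℕ) : (i, j) ∈ diagram l ↔ j < l.1 i := by
  rw [← YoungDiagram.mem_cells]
  simp only [diagram, Finset.mem_biUnion, Finsupp.mem_support_iff, Finset.mem_image,
    Finset.mem_range, Prod.mk.injEq]
  constructor
  · rintro ⟨r, hr, c, hc, rfl, rfl⟩
    exact hc
  · intro h
    exact ⟨i, by omega, j, h, rfl, rfl⟩

/-- Symplectic tableaux of shape `l`: semistandard fillings with letters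
`1 < 1bar < 2 < 2bar < … < n < nbar` such that no letter smaller than `i` occurs in row `i`.
The letter `k` is encoded as `2(k-1)` and the letter `kbar` as `2(k-1)+1`; rows are indexed
from `0`. -/
def tableauSet (n : ℕ) (l : Lam n) : Set (SemistandardYoungTableau (diagram l)) :=
  {T | ∀ i j, (i, j) ∈ diagram l → T i j < 2 * n ∧ 2 * i ≤ T i j}

theorem tableauSet_finite (n : ℕ) (l : Lam n) : (tableauSet n l).Finite := by
  let F : SemistandardYoungTableau (diagram l) → ((diagram l).cells → ℕ) :=
    fun T c => T c.1.1 c.1.2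
  have hF : Function.Injective F := by
    intro T T' h
    ext i j
    by_cases hc : (i, j) ∈ diagram l
    · exact congrFun h ⟨(i, j), hc⟩
    · rw [T.zeros hc, T'.zeros hc]
  refine Set.Finite.of_finite_image ((Set.Finite.pi' (fun _ : (diagram l).cells =>
    Set.finite_Iio (2 * n))).subset ?_) hF.injOn
  rintro _ ⟨T, hT, rfl⟩ c
  exact (hT c.1.1 c.1.2 c.2).1

/-- `a^T = ∏_k a_k^{#k - #kbar}`. -/
noncomputable def tableauMonomial {n : ℕ} (a : Fin n → ℝ) {l : Lam n}
    (T : SemistandardYoungTableau (diagram l)) : ℝ :=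
  ∏ k : Fin n, a k ^
    ((((diagram l).cells.filter fun c => T c.1 c.2 = 2 * (k : ℕ)).card : ℤ)
      - (((diagram l).cells.filter fun c => T c.1 c.2 = 2 * (k : ℕ) + 1).card : ℤ))

/-- The symplectic Schur function `Sp^{(n)}_λ(a)`. -/
noncomputable def sympSchur (n : ℕ) (a : Fin n → ℝ) (l : Lam n) : ℝ :=
  ∑ T ∈ (tableauSet_finite n l).toFinset, tableauMonomial a T

end QBerele

/-!
The functions `P_λ = qSymp n a q λ` satisfy the eigenfunction equation
`∑_μ L_n(λ, μ) P_μ = (∑ a_i + a_i⁻¹) P_λ` (`kernelSum_qSymp`). Since `Q^λ_m` is the `m`-step weight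
from the empty partition, with `Q_{m+1} = Q_m L_n` (`oscWeight_succ`), and `P_∅ = 1`, the expansion
of the `m`-th power follows by induction on `m` (`sum_oscWeight_mul_qSymp`).

The eigenfunction equation is proved by induction on `n`. Grouping patterns by their levels
`u = z^{2n-2}` and `v = z^{2n-1}` gives the branching rule
`P^{(n)}_l = ∑_{u, v} a_n^{2|v| - |l| - |u|} w(l, v, u) P^{(n-1)}_u` (`qSymp_succ`), so it is enough
that `L_n` acting on `l` equals, after summation over `v`, the scalar `a_n + a_n⁻¹` plus the
transpose of `L_{n-1}` acting on `u` (`sum_stepWeight`). Comparing powers of `a_n`, this is an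
identity between a sum over rows `v` of size `N` and a sum over rows `v` of size `N - 1`. It
telescopes: there are functions `G_i(v)`, called `flux` below, such that the summand of the first
is `∑_i G_i(v)` (`sum_flux`) and the summand of the second is `∑_i G_i(v + e_i)`
(`sum_flux_add_unitSeq`). In terms of `X_i = q^{l_i}`, `Y_i = q^{v_i}`, `Z_i = q^{u_i}` the flux is
`G_i = w (1 - q Y_{i-1}/Y_i)
  ((1 - Y_i/X_{i+1})/(1 - q X_i/Y_i) - (1 - Y_i/Z_i)/(1 - q Z_{i-1}/Y_i))`,
where `w` is the branching weight `stepWeight` and terms with index `i - 1` are dropped in the first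
row. The denominators can vanish where rows stop interlacing; to avoid division, `1/(q;q)_m` is
extended by zero to negative `m` and each quotient is written as a shift of one argument of the weight.

As `q → 0` every `q`-binomial coefficient and every weight of an allowed step tends to `1`. Thus
`Q^λ_m` tends to the number of tableaux and `P_λ` to the generating function of patterns, which the
bijection `T ↦ (shapes of the entries smaller than k)_k` identifies with the symplectic Schur
function (`sympSchur_eq_sum_gtMonomial`). All sums over `λ` are finite, uniformly in `q`, so the
expansion passes to the limit.
-/

namespace QBerele

/-! ### The q-Pochhammer symbol at integer arguments -/

/-- `(q;q)_m` for an integer `m`, with value `1` at negative `m`. -/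
noncomputable def qPochInt (q : ℝ) (m : ℤ) : ℝ := qPoch q m.toNat

/-- `1/(q;q)_m` for an integer `m`, with the convention that it vanishes at negative `m`; with
this convention the recursion `qPochInv_sub_one` holds at every integer. -/
noncomputable def qPochInv (q : ℝ) (m : ℤ) : ℝ := if 0 ≤ m then (qPoch q m.toNat)⁻¹ else 0

theorem qPoch_succ (q : ℝ) (N : ℕ) : qPoch q (N + 1) = qPoch q N * (1 - q ^ (N + 1)) := by
  unfold qPoch
  rw [Finset.prod_Icc_succ_top (by omega)]

theorem qPoch_ne_zero {q : ℝ} (h0 : 0 < q) (h1 : q < 1) (N : ℕ) : qPoch q N ≠ 0 := by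
  unfold qPoch
  refine Finset.prod_ne_zero_iff.2 fun k hk => ?_
  have hk' : k ≠ 0 := by
    have := (Finset.mem_Icc.1 hk).1
    omega
  have := pow_lt_one₀ h0.le h1 hk'
  linarith

theorem qPochInt_add_one (q : ℝ) {m : ℤ} (hm : 0 ≤ m) :
    qPochInt q (m + 1) = (1 - q ^ (m + 1)) * qPochInt q m := by
  lift m to ℕ using hm
  have : ((m : ℤ) + 1).toNat = m + 1 := by omega
  unfold qPochInt
  rw [this, qPoch_succ, Int.toNat_natCast, mul_comm]
  norm_cast

theorem qPochInv_sub_one {q : ℝ} (h0 : 0 < q) (h1 : q < 1) (m : ℤ) :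
    qPochInv q (m - 1) = (1 - q ^ m) * qPochInv q m := by
  rcases lt_trichotomy m 0 with h | h | h
  · simp [qPochInv, h.not_ge, show ¬ (1 ≤ m) by omega]
  · simp [h, qPochInv]
  · obtain ⟨N, rfl⟩ : ∃ N : ℕ, m = N + 1 := ⟨(m - 1).toNat, by omega⟩
    have h2 : ((N : ℤ) + 1).toNat = N + 1 := by omega
    have h3 : 1 - q ^ (N + 1) ≠ 0 := by
      have := pow_lt_one₀ h0.le h1 (Nat.succ_ne_zero N)
      simp only [Nat.succ_eq_add_one] at this
      linarith
    have h4 := qPoch_ne_zero h0 h1 N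
    have h5 : (q : ℝ) ^ ((N : ℤ) + 1) = q ^ (N + 1) := by norm_cast
    simp only [qPochInv, add_sub_cancel_right, Int.natCast_nonneg, if_true, Int.toNat_natCast,
      h.le, h2, qPoch_succ, h5]
    field_simp

theorem qPochInv_eq_zero {q : ℝ} {m : ℤ} (h : m < 0) : qPochInv q m = 0 := by
  simp [qPochInv, h]

/-! ### Products over the gaps of two integer sequences -/

/-- The unit sequence `e_i`. -/
def unitSeq (i : ℕ) : ℕ → ℤ := Pi.single i 1

/-- The sequence with its first term dropped. -/
def tailSeq (f : ℕ → ℤ) : ℕ → ℤ := fun i => f (i + 1)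

/-- The product of `h (f_i - g_i)` over `i < n`. -/
noncomputable def gapProd (h : ℤ → ℝ) (n : ℕ) (f g : ℕ → ℤ) : ℝ :=
  ∏ i ∈ Finset.range n, h (f i - g i)

theorem unitSeq_self (i : ℕ) : unitSeq i i = 1 := by simp [unitSeq]

theorem unitSeq_of_ne {i j : ℕ} (h : j ≠ i) : unitSeq i j = 0 := by simp [unitSeq, h]

theorem tailSeq_add_unitSeq_succ (f : ℕ → ℤ) (i : ℕ) :
    tailSeq (f + unitSeq (i + 1)) = tailSeq f + unitSeq i := by
  funext j
  simp [tailSeq, unitSeq, Pi.single_apply]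

theorem tailSeq_add_unitSeq_zero (f : ℕ → ℤ) : tailSeq (f + unitSeq 0) = tailSeq f := by
  funext j
  simp [tailSeq, unitSeq]

theorem tailSeq_sub_unitSeq_succ (f : ℕ → ℤ) (i : ℕ) :
    tailSeq (f - unitSeq (i + 1)) = tailSeq f - unitSeq i := by
  funext j
  simp [tailSeq, unitSeq, Pi.single_apply]

theorem tailSeq_sub_unitSeq_zero (f : ℕ → ℤ) : tailSeq (f - unitSeq 0) = tailSeq f := by
  funext j
  simp [tailSeq, unitSeq]

theorem gapProd_add_add (h : ℤ → ℝ) (n : ℕ) (f g e : ℕ → ℤ) :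
    gapProd h n (f + e) (g + e) = gapProd h n f g := by
  simp [gapProd]

theorem gapProd_sub_left (h : ℤ → ℝ) (n : ℕ) (f g e : ℕ → ℤ) :
    gapProd h n (f - e) g = gapProd h n f (g + e) := by
  simp [gapProd, sub_sub, add_comm]

theorem gapProd_sub_right (h : ℤ → ℝ) (n : ℕ) (f g e : ℕ → ℤ) :
    gapProd h n f (g - e) = gapProd h n (f + e) g := by
  simp [gapProd, sub_sub_eq_add_sub]

theorem gapProd_eq_zero {q : ℝ} {n : ℕ} {f g : ℕ → ℤ} {i : ℕ} (hi : i < n) (h : f i < g i) :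
    gapProd (qPochInv q) n f g = 0 :=
  Finset.prod_eq_zero (Finset.mem_range.2 hi) (qPochInv_eq_zero (by omega))

theorem le_of_gapProd_ne_zero {q : ℝ} {n : ℕ} {f g : ℕ → ℤ}
    (h : gapProd (qPochInv q) n f g ≠ 0) {i : ℕ} (hi : i < n) : g i ≤ f i :=
  not_lt.1 fun hlt => h (gapProd_eq_zero hi hlt)

theorem gapProd_add_unitSeq {h : ℤ → ℝ} {n : ℕ} {f g : ℕ → ℤ} {i : ℕ} (hi : i < n) {c d : ℝ}
    (H : c * h (f i + 1 - g i) = d * h (f i - g i)) :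
    c * gapProd h n (f + unitSeq i) g = d * gapProd h n f g := by
  have hi' := Finset.mem_range.2 hi
  unfold gapProd
  rw [← Finset.mul_prod_erase _ _ hi', ← Finset.mul_prod_erase (Finset.range n)
    (fun i => h (f i - g i)) hi', ← mul_assoc, ← mul_assoc, Pi.add_apply, unitSeq_self, H]
  congr 1
  refine Finset.prod_congr rfl fun j hj => ?_
  rw [Pi.add_apply, unitSeq_of_ne (Finset.ne_of_mem_erase hj), add_zero]

theorem gapProd_inv_left {q : ℝ} (h0 : 0 < q) (h1 : q < 1) {n : ℕ} (f g : ℕ → ℤ) {i : ℕ}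
    (hi : i < n) :
    gapProd (qPochInv q) n f g
      = (1 - q ^ (f i + 1 - g i)) * gapProd (qPochInv q) n (f + unitSeq i) g := by
  rw [gapProd_add_unitSeq (d := 1) hi, one_mul]
  rw [one_mul, ← qPochInv_sub_one h0 h1]
  congr 1
  ring

theorem gapProd_inv_right {q : ℝ} (h0 : 0 < q) (h1 : q < 1) {n : ℕ} (f g : ℕ → ℤ) {i : ℕ}
    (hi : i < n) :
    gapProd (qPochInv q) n f (g + unitSeq i)
      = (1 - q ^ (f i - g i)) * gapProd (qPochInv q) n f g := by
  rw [gapProd_inv_left h0 h1 f (g + unitSeq i) hi, gapProd_add_add]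
  simp [unitSeq_self]

/-- The product of `(q;q)_{f_i - f_{i+1}}` over `i < n`. -/
noncomputable def gapPoch (q : ℝ) (n : ℕ) (f : ℕ → ℤ) : ℝ :=
  gapProd (qPochInt q) n f (tailSeq f)

theorem gapPoch_add_unitSeq_zero {q : ℝ} {n : ℕ} {f : ℕ → ℤ} (hn : 0 < n) (h : f 1 ≤ f 0) :
    gapPoch q n (f + unitSeq 0) = (1 - q ^ (f 0 + 1 - f 1)) * gapPoch q n f := by
  unfold gapPoch
  rw [tailSeq_add_unitSeq_zero, ← gapProd_add_unitSeq (c := 1) hn, one_mul]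
  have := qPochInt_add_one q (m := f 0 - f 1) (by omega)
  simp only [tailSeq]
  rw [one_mul, show f 0 + 1 - f (0 + 1) = f 0 - f 1 + 1 by ring, this]

theorem gapPoch_add_unitSeq_succ {q : ℝ} {n : ℕ} {f : ℕ → ℤ} {j : ℕ} (hj : j + 1 < n)
    (h : f (j + 2) ≤ f (j + 1)) (h' : f (j + 1) < f j) :
    (1 - q ^ (f j - f (j + 1))) * gapPoch q n (f + unitSeq (j + 1))
      = (1 - q ^ (f (j + 1) + 1 - f (j + 2))) * gapPoch q n f := by
  unfold gapPoch
  have e1 : 1 * gapProd (qPochInt q) n (f + unitSeq (j + 1)) (tailSeq f)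
      = (1 - q ^ (f (j + 1) + 1 - f (j + 2))) * gapProd (qPochInt q) n f (tailSeq f) := by
    refine gapProd_add_unitSeq hj ?_
    have := qPochInt_add_one q (m := f (j + 1) - f (j + 2)) (by omega)
    simp only [tailSeq]
    rw [one_mul, show f (j + 1) + 1 - f (j + 1 + 1) = f (j + 1) - f (j + 2) + 1 by ring, this]
  have e2 : 1 * gapProd (qPochInt q) n (f + unitSeq (j + 1) + unitSeq j) (tailSeq f + unitSeq j)
      = (1 - q ^ (f j - f (j + 1)))
        * gapProd (qPochInt q) n (f + unitSeq (j + 1)) (tailSeq f + unitSeq j) := by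
    refine gapProd_add_unitSeq (by omega) ?_
    have := qPochInt_add_one q (m := f j - f (j + 1) - 1) (by omega)
    simp only [tailSeq, Pi.add_apply, unitSeq_self, unitSeq_of_ne (show j ≠ j + 1 by omega)]
    rw [sub_add_cancel] at this
    rw [one_mul, show f j + 0 + 1 - (f (j + 1) + 1) = f j - f (j + 1) by ring, this,
      show f j + 0 - (f (j + 1) + 1) = f j - f (j + 1) - 1 by ring]
  rw [tailSeq_add_unitSeq_succ, ← e2, gapProd_add_add, one_mul, ← e1, one_mul]

/-- The three-term relation behind the telescoping. -/
theorem zpow_three_term {q : ℝ} (h0 : q ≠ 0) (a b c d : ℤ) :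
    (1 - q ^ (a - b + 1)) * (1 - q ^ (b - c))
      = (1 - q ^ (d + 1 - c)) * (1 - q ^ (a - d))
        + (1 - q ^ (d + 1 - b)) * (q ^ (a - d) - q ^ (b - c)) := by
  simp only [zpow_sub₀ h0, zpow_add₀ h0, zpow_one]
  have ha := zpow_ne_zero a h0
  have hb := zpow_ne_zero b h0
  have hc := zpow_ne_zero c h0
  have hd := zpow_ne_zero d h0
  field_simp
  ring

/-! ### The branching weight and its flux -/

/-- The weight of two consecutive steps `z ≼ y ≼ x` of a symplectic Gelfand-Tsetlin pattern, the
rows being integer sequences; it vanishes unless the three rows interlace. -/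
noncomputable def stepWeight (q : ℝ) (n : ℕ) (x y z : ℕ → ℤ) : ℝ :=
  gapPoch q n x * gapPoch q n y * (gapProd (qPochInv q) n x y *
    gapProd (qPochInv q) n y (tailSeq x) * gapProd (qPochInv q) n y z *
    gapProd (qPochInv q) n z (tailSeq y))

/-- `u^+_{i+1}` on integer sequences. -/
noncomputable def upFactor (q : ℝ) (x : ℕ → ℤ) : ℕ → ℝ
  | 0 => 1
  | j + 1 => 1 - q ^ (x j - x (j + 1))

/-- `u^-_{i+1}` on integer sequences. -/
noncomputable def downFactor (q : ℝ) (x : ℕ → ℤ) (i : ℕ) : ℝ := 1 - q ^ (x i - x (i + 1))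

/-- The flux through the middle row `y` in direction `i`. The sum of the fluxes at `y` and their
sum at the shifted rows `y + e_i` are the two sides of the branching identity, see
`sum_flux` and `sum_flux_add_unitSeq`. -/
noncomputable def flux (q : ℝ) (n : ℕ) (x y z : ℕ → ℤ) : ℕ → ℝ
  | 0 => gapPoch q n x * gapPoch q n y *
      (((1 - q ^ (y 0 - x 1)) * gapProd (qPochInv q) n (x + unitSeq 0) y -
        (1 - q ^ (y 0 - z 0)) * gapProd (qPochInv q) n x y) *
        gapProd (qPochInv q) n y (tailSeq x) * gapProd (qPochInv q) n y z *
        gapProd (qPochInv q) n z (tailSeq y))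
  | j + 1 => (1 - q ^ (y j - y (j + 1) + 1)) * (gapPoch q n x * gapPoch q n y) *
      ((1 - q ^ (y (j + 1) - x (j + 2))) * (gapProd (qPochInv q) n (x + unitSeq (j + 1)) y *
          gapProd (qPochInv q) n y (tailSeq x) * gapProd (qPochInv q) n y z *
          gapProd (qPochInv q) n z (tailSeq y)) -
        (1 - q ^ (y (j + 1) - z (j + 1))) * (gapProd (qPochInv q) n x y *
          gapProd (qPochInv q) n y (tailSeq x) * gapProd (qPochInv q) n y z *
          gapProd (qPochInv q) n (z + unitSeq j) (tailSeq y)))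

theorem upFactor_mul_stepWeight_zero {q : ℝ} {n : ℕ} (hn : 0 < n) {x : ℕ → ℤ} (hx : Antitone x)
    (y z : ℕ → ℤ) :
    upFactor q x 0 * stepWeight q n (x + unitSeq 0) y z
      = (1 - q ^ (x 0 + 1 - x 1)) * (gapPoch q n x * gapPoch q n y) *
        (gapProd (qPochInv q) n (x + unitSeq 0) y * gapProd (qPochInv q) n y (tailSeq x) *
          gapProd (qPochInv q) n y z * gapProd (qPochInv q) n z (tailSeq y)) := by
  rw [stepWeight, gapPoch_add_unitSeq_zero hn (hx (by omega)), tailSeq_add_unitSeq_zero, upFactor]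
  ring

theorem upFactor_mul_stepWeight_succ {q : ℝ} (h0 : 0 < q) (h1 : q < 1) {n j : ℕ} (hj : j + 1 < n)
    {x : ℕ → ℤ} (hx : Antitone x) (y z : ℕ → ℤ) :
    upFactor q x (j + 1) * stepWeight q n (x + unitSeq (j + 1)) y z
      = (1 - q ^ (x (j + 1) + 1 - x (j + 2))) * (1 - q ^ (y j - x (j + 1))) *
        (gapPoch q n x * gapPoch q n y) *
        (gapProd (qPochInv q) n (x + unitSeq (j + 1)) y * gapProd (qPochInv q) n y (tailSeq x) *
          gapProd (qPochInv q) n y z * gapProd (qPochInv q) n z (tailSeq y)) := by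
  have hB := gapProd_inv_right h0 h1 y (tailSeq x) (show j < n by omega)
  rw [stepWeight, tailSeq_add_unitSeq_succ, upFactor]
  by_cases h : x (j + 1) < x j
  · have hP := gapPoch_add_unitSeq_succ (q := q) hj (hx (show j + 1 ≤ j + 2 by omega)) h
    rw [hB]
    simp only [tailSeq]
    linear_combination (gapPoch q n y * gapProd (qPochInv q) n (x + unitSeq (j + 1)) y *
      ((1 - q ^ (y j - x (j + 1))) * gapProd (qPochInv q) n y (tailSeq x)) *
          gapProd (qPochInv q) n y z * gapProd (qPochInv q) n z (tailSeq y)) * hP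
  · have hxx : x j = x (j + 1) := le_antisymm (not_lt.1 h) (hx (by omega))
    have hz : gapProd (qPochInv q) n (x + unitSeq (j + 1)) y *
        ((1 - q ^ (y j - x (j + 1))) * gapProd (qPochInv q) n y (tailSeq x)) = 0 := by
      rcases lt_or_ge (x j) (y j) with h2 | h2
      · rw [gapProd_eq_zero (show j < n by omega), zero_mul]
        simpa [unitSeq_of_ne (show j ≠ j + 1 by omega)] using h2
      · have hB0 : gapProd (qPochInv q) n y (tailSeq x + unitSeq j) = 0 := by
          refine gapProd_eq_zero (show j < n by omega) ?_
          simp only [tailSeq, Pi.add_apply, unitSeq_self]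
          omega
        simp only [tailSeq] at hB hB0
        rw [← hB, hB0, mul_zero]
    rw [hxx, sub_self, zpow_zero, sub_self, zero_mul]
    linear_combination (-(1 - q ^ (x (j + 1) + 1 - x (j + 2))) * (gapPoch q n x * gapPoch q n y) *
          gapProd (qPochInv q) n y z * gapProd (qPochInv q) n z (tailSeq y)) * hz

theorem downFactor_mul_stepWeight_lower {q : ℝ} (h0 : 0 < q) (h1 : q < 1) {n j : ℕ}
    (hj : j + 1 < n) (x y z : ℕ → ℤ) :
    downFactor q (z + unitSeq j) j * stepWeight q n x y (z + unitSeq j)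
      = (1 - q ^ (z j + 1 - z (j + 1))) * (1 - q ^ (y j - z j)) *
        (gapPoch q n x * gapPoch q n y) *
        (gapProd (qPochInv q) n x y * gapProd (qPochInv q) n y (tailSeq x) *
          gapProd (qPochInv q) n y z * gapProd (qPochInv q) n (z + unitSeq j) (tailSeq y)) := by
  rw [stepWeight, gapProd_inv_right h0 h1 y z (show j < n by omega), downFactor]
  simp only [Pi.add_apply, unitSeq_self, unitSeq_of_ne (show j + 1 ≠ j by omega), add_zero]
  ring

theorem flux_zero {q : ℝ} (h0 : 0 < q) (h1 : q < 1) {n : ℕ} (hn : 0 < n) {x : ℕ → ℤ}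
    (hx : Antitone x) (y z : ℕ → ℤ) :
    flux q n x y z 0 = upFactor q x 0 * stepWeight q n (x + unitSeq 0) y z
      + stepWeight q n x y z * (q ^ (y 0 - z 0) - q ^ (y 0 - x 1) - 1) := by
  rw [upFactor_mul_stepWeight_zero hn hx, flux, stepWeight, gapProd_inv_left h0 h1 x y hn]
  have : (q : ℝ) ^ (x 0 + 1 - x 1) = q ^ (x 0 + 1 - y 0) * q ^ (y 0 - x 1) := by
    rw [← zpow_add₀ h0.ne']
    congr 1
    ring
  rw [this]
  ring

theorem flux_succ {q : ℝ} (h0 : 0 < q) (h1 : q < 1) {n j : ℕ} (hj : j + 1 < n) {x : ℕ → ℤ}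
    (hx : Antitone x) (y z : ℕ → ℤ) :
    flux q n x y z (j + 1) = upFactor q x (j + 1) * stepWeight q n (x + unitSeq (j + 1)) y z
      - downFactor q (z + unitSeq j) j * stepWeight q n x y (z + unitSeq j)
      + stepWeight q n x y z * ((q ^ (y (j + 1) - z (j + 1)) - q ^ (y (j + 1) - x (j + 2)))
        - (q ^ (y j - z j) - q ^ (y j - x (j + 1)))) := by
  rw [upFactor_mul_stepWeight_succ h0 h1 hj hx, downFactor_mul_stepWeight_lower h0 h1 hj, flux,
    stepWeight]
  have hA := gapProd_inv_left h0 h1 x y hj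
  have hE := gapProd_inv_left h0 h1 z (tailSeq y) (show j < n by omega)
  simp only [tailSeq] at hE
  have t1 := zpow_three_term h0.ne' (y j) (y (j + 1)) (x (j + 2)) (x (j + 1))
  have t2 := zpow_three_term h0.ne' (y j) (y (j + 1)) (z (j + 1)) (z j)
  generalize gapPoch q n x * gapPoch q n y = Φ at *
  generalize gapProd (qPochInv q) n x y = A at *
  generalize gapProd (qPochInv q) n (x + unitSeq (j + 1)) y = A' at *
  generalize gapProd (qPochInv q) n z _ = E at *
  generalize gapProd (qPochInv q) n (z + unitSeq j) _ = E' at *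
  generalize gapProd (qPochInv q) n y z = C at *
  generalize gapProd (qPochInv q) n y _ = B at *
  linear_combination (Φ * A' * B * C * E) * t1 - (Φ * A * B * C * E') * t2
    - Φ * B * C * E * (q ^ (y j - x (j + 1)) - q ^ (y (j + 1) - x (j + 2))) * hA
    + Φ * A * B * C * (q ^ (y j - z j) - q ^ (y (j + 1) - z (j + 1))) * hE

theorem sum_flux {q : ℝ} (h0 : 0 < q) (h1 : q < 1) (k : ℕ) {x : ℕ → ℤ} (hx : Antitone x)
    (y z : ℕ → ℤ) (hxk : x (k + 1) = 0) (hzk : z k = 0) :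
    ∑ i ∈ Finset.range (k + 1), flux q (k + 1) x y z i
      = ∑ i ∈ Finset.range (k + 1), upFactor q x i * stepWeight q (k + 1) (x + unitSeq i) y z
        - stepWeight q (k + 1) x y z
        - ∑ i ∈ Finset.range k,
          downFactor q (z + unitSeq i) i * stepWeight q (k + 1) x y (z + unitSeq i) := by
  have key : ∀ j ∈ Finset.range k, flux q (k + 1) x y z (j + 1) = _ := fun j hj =>
    flux_succ h0 h1 (by simpa using hj) hx y z
  rw [Finset.sum_range_succ', Finset.sum_range_succ', Finset.sum_congr rfl key,
    flux_zero h0 h1 k.succ_pos hx, Finset.sum_add_distrib, Finset.sum_sub_distrib,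
    ← Finset.mul_sum,
    Finset.sum_range_sub (fun j => (q : ℝ) ^ (y j - z j) - q ^ (y j - x (j + 1))), hxk, hzk]
  ring

/-! ### The flux at the translates of the middle row -/

theorem downFactor_mul_stepWeight_upper {q : ℝ} (h0 : 0 < q) (h1 : q < 1) {n j : ℕ}
    (hj : j + 1 < n) {x : ℕ → ℤ} (hx : Antitone x) (y z : ℕ → ℤ) :
    downFactor q x (j + 1) * stepWeight q n (x - unitSeq (j + 1)) y z
      = (1 - q ^ (x j - x (j + 1) + 1)) * (1 - q ^ (x (j + 1) - y (j + 1))) *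
        (gapPoch q n x * gapPoch q n y) *
        (gapProd (qPochInv q) n x y * gapProd (qPochInv q) n (y + unitSeq j) (tailSeq x) *
          gapProd (qPochInv q) n y z * gapProd (qPochInv q) n z (tailSeq y)) := by
  have hA := gapProd_inv_right h0 h1 x y hj
  rw [stepWeight, tailSeq_sub_unitSeq_succ, gapProd_sub_left, gapProd_sub_right, downFactor]
  by_cases h : x (j + 2) < x (j + 1)
  · have hP := gapPoch_add_unitSeq_succ (q := q) (f := x - unitSeq (j + 1)) hj
      (by simp [unitSeq_self, unitSeq_of_ne (show j + 2 ≠ j + 1 by omega)]; omega)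
      (by have := hx (show j ≤ j + 1 by omega)
          simp [unitSeq_self, unitSeq_of_ne (show j ≠ j + 1 by omega)]; omega)
    simp only [Pi.sub_apply, unitSeq_self, unitSeq_of_ne (show j + 2 ≠ j + 1 by omega),
      unitSeq_of_ne (show j ≠ j + 1 by omega), sub_add_cancel, sub_zero] at hP
    rw [show x j - (x (j + 1) - 1) = x j - x (j + 1) + 1 by ring] at hP
    rw [hA]
    linear_combination (-gapPoch q n y * gapProd (qPochInv q) n x y *
      ((1 - q ^ (x (j + 1) - y (j + 1))) *
        gapProd (qPochInv q) n (y + unitSeq j) (tailSeq x)) *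
          gapProd (qPochInv q) n y z * gapProd (qPochInv q) n z (tailSeq y)) * hP
  · have hxx : x (j + 1) = x (j + 2) := le_antisymm (not_lt.1 h) (hx (by omega))
    have hz : (1 - q ^ (x (j + 1) - y (j + 1))) * gapProd (qPochInv q) n x y *
        gapProd (qPochInv q) n (y + unitSeq j) (tailSeq x) = 0 := by
      by_contra hne
      rw [← hA] at hne
      have g1 := le_of_gapProd_ne_zero (left_ne_zero_of_mul hne) hj
      have g2 := le_of_gapProd_ne_zero (right_ne_zero_of_mul hne) hj
      simp only [tailSeq, Pi.add_apply, unitSeq_self, unitSeq_of_ne (show j + 1 ≠ j by omega),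
        add_zero] at g1 g2
      rw [show j + 1 + 1 = j + 2 from rfl] at g2
      omega
    have hd : (1 : ℝ) - q ^ (x (j + 1) - x (j + 1 + 1)) = 0 := by
      rw [hxx, sub_self, zpow_zero, sub_self]
    rw [hd]
    linear_combination (-(1 - q ^ (x j - x (j + 1) + 1)) * (gapPoch q n x * gapPoch q n y) *
          gapProd (qPochInv q) n y z * gapProd (qPochInv q) n z (tailSeq y)) * hz

theorem downFactor_mul_stepWeight_upper_zero {q : ℝ} (h0 : 0 < q) (h1 : q < 1) {n : ℕ}
    (hn : 0 < n) {x : ℕ → ℤ} (hx : Antitone x) (y z : ℕ → ℤ) :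
    downFactor q x 0 * stepWeight q n (x - unitSeq 0) y z
      = (1 - q ^ (x 0 - y 0)) * stepWeight q n x y z := by
  have hA := gapProd_inv_right h0 h1 x y hn
  rw [stepWeight, stepWeight, tailSeq_sub_unitSeq_zero, gapProd_sub_left, downFactor]
  by_cases h : x 1 < x 0
  · have hP := gapPoch_add_unitSeq_zero (q := q) (f := x - unitSeq 0) hn
      (by simp [unitSeq_self, unitSeq_of_ne (show 1 ≠ 0 by omega)]; omega)
    simp only [Pi.sub_apply, unitSeq_self, unitSeq_of_ne (show 1 ≠ 0 by omega),
      sub_add_cancel, sub_zero] at hP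
    rw [hA, hP]
    ring
  · have hxx : x 0 = x (0 + 1) := le_antisymm (not_lt.1 h) (hx (by omega))
    have hz : (1 - q ^ (x 0 - y 0)) * gapProd (qPochInv q) n x y *
        gapProd (qPochInv q) n y (tailSeq x) = 0 := by
      by_contra hne
      rw [← hA] at hne
      have g1 := le_of_gapProd_ne_zero (left_ne_zero_of_mul hne) hn
      have g2 := le_of_gapProd_ne_zero (right_ne_zero_of_mul hne) hn
      simp only [tailSeq, Pi.add_apply, unitSeq_self, zero_add] at g1 g2
      omega
    have hd : (1 : ℝ) - q ^ (x 0 - x (0 + 1)) = 0 := by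
      rw [← hxx, sub_self, zpow_zero, sub_self]
    rw [hd]
    linear_combination (-(gapPoch q n x * gapPoch q n y) *
          gapProd (qPochInv q) n y z * gapProd (qPochInv q) n z (tailSeq y)) * hz

theorem flux_add_unitSeq_zero {q : ℝ} (h0 : 0 < q) (h1 : q < 1) {n : ℕ} (hn : 0 < n)
    (x y z : ℕ → ℤ) (hxy : y n ≤ x n) :
    flux q n x (y + unitSeq 0) z 0 = (1 - q ^ (y 0 + 1 - y 1)) * (gapPoch q n x * gapPoch q n y) *
      ((gapProd (qPochInv q) n x y * gapProd (qPochInv q) n y (tailSeq x) *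
          gapProd (qPochInv q) n (y + unitSeq 0) z * gapProd (qPochInv q) n z (tailSeq y)) -
        (1 - q ^ (x 0 - y 0)) * (gapProd (qPochInv q) n x y *
          gapProd (qPochInv q) n (y + unitSeq 0) (tailSeq x) * gapProd (qPochInv q) n y z *
          gapProd (qPochInv q) n z (tailSeq y))) := by
  have hA := gapProd_inv_right h0 h1 x y hn
  have hB := gapProd_inv_left h0 h1 y (tailSeq x) hn
  have hC := gapProd_inv_left h0 h1 y z hn
  simp only [tailSeq] at hB
  rw [flux, gapProd_add_add, tailSeq_add_unitSeq_zero, hA]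
  simp only [Pi.add_apply, unitSeq_self]
  -- The weight factors force `y 1 ≤ y 0`, and only then the Pochhammer recursion applies.
  by_cases hg : y 1 ≤ y 0
  · rw [gapPoch_add_unitSeq_zero hn hg, hB, hC]
    ring
  · have hT1 : gapProd (qPochInv q) n x y * gapProd (qPochInv q) n y (tailSeq x) = 0 := by
      by_contra hne
      have g1 : y 1 ≤ x 1 := by
        rcases Nat.lt_or_ge 1 n with h | h
        · exact le_of_gapProd_ne_zero (left_ne_zero_of_mul hne) h
        · obtain rfl : n = 1 := by omega
          exact hxy
      have g2 := le_of_gapProd_ne_zero (right_ne_zero_of_mul hne) hn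
      simp only [tailSeq, zero_add] at g2
      omega
    have hT2 : gapProd (qPochInv q) n y z * gapProd (qPochInv q) n z (tailSeq y) = 0 := by
      by_contra hne
      have g1 := le_of_gapProd_ne_zero (left_ne_zero_of_mul hne) hn
      have g2 := le_of_gapProd_ne_zero (right_ne_zero_of_mul hne) hn
      simp only [tailSeq, zero_add] at g2
      omega
    rw [hB] at hT1 ⊢
    rw [hC] at hT2 ⊢
    linear_combination (gapPoch q n x * gapPoch q n (y + unitSeq 0)
        - (1 - q ^ (y 0 + 1 - y 1)) * (gapPoch q n x * gapPoch q n y)) *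
      (gapProd (qPochInv q) n (y + unitSeq 0) z * gapProd (qPochInv q) n z (tailSeq y) * hT1
        - (1 - q ^ (x 0 - y 0)) * gapProd (qPochInv q) n x y *
          gapProd (qPochInv q) n (y + unitSeq 0) (tailSeq x) * hT2)

theorem flux_add_unitSeq_succ {q : ℝ} (h0 : 0 < q) (h1 : q < 1) {n j : ℕ} (hj : j + 1 < n)
    (x y z : ℕ → ℤ) (hxy : y n ≤ x n) :
    flux q n x (y + unitSeq (j + 1)) z (j + 1)
      = (1 - q ^ (y (j + 1) + 1 - y (j + 2))) * (gapPoch q n x * gapPoch q n y) *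
      ((1 - q ^ (z j - y (j + 1))) * (gapProd (qPochInv q) n x y *
          gapProd (qPochInv q) n y (tailSeq x) *
          gapProd (qPochInv q) n (y + unitSeq (j + 1)) z * gapProd (qPochInv q) n z (tailSeq y)) -
        (1 - q ^ (x (j + 1) - y (j + 1))) * (gapProd (qPochInv q) n x y *
          gapProd (qPochInv q) n (y + unitSeq (j + 1)) (tailSeq x) * gapProd (qPochInv q) n y z *
          gapProd (qPochInv q) n z (tailSeq y))) := by
  have hj' : j < n := by omega
  have hA := gapProd_inv_right h0 h1 x y hj
  have hB := gapProd_inv_left h0 h1 y (tailSeq x) hj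
  have hC := gapProd_inv_left h0 h1 y z hj
  have hE := gapProd_inv_right h0 h1 z (tailSeq y) hj'
  simp only [tailSeq] at hB hE
  rw [flux, gapProd_add_add, tailSeq_add_unitSeq_succ, gapProd_add_add]
  simp only [Pi.add_apply, unitSeq_self, unitSeq_of_ne (show j ≠ j + 1 by omega), add_zero]
  rw [show y j - (y (j + 1) + 1) + 1 = y j - y (j + 1) by ring]
  -- The weight factors force `y (j + 2) ≤ y (j + 1) < y j`, and only then the Pochhammer
  -- recursion applies.
  by_cases hg : y (j + 2) ≤ y (j + 1) ∧ y (j + 1) < y j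
  · have hP := gapPoch_add_unitSeq_succ (q := q) hj hg.1 hg.2
    rw [hE, hA, hB, hC]
    rw [show j + 1 + 1 = j + 2 from rfl]
    linear_combination (gapPoch q n x * gapProd (qPochInv q) n x y *
      gapProd (qPochInv q) n (y + unitSeq (j + 1)) (tailSeq x) *
      gapProd (qPochInv q) n (y + unitSeq (j + 1)) z * gapProd (qPochInv q) n z (tailSeq y) *
      ((1 - q ^ (y (j + 1) + 1 - x (j + 2))) * (1 - q ^ (z j - y (j + 1)))
        - (1 - q ^ (y (j + 1) + 1 - z (j + 1))) * (1 - q ^ (x (j + 1) - y (j + 1))))) * hP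
  · have hT1 : gapProd (qPochInv q) n x y * gapProd (qPochInv q) n y (tailSeq x) *
        gapProd (qPochInv q) n (y + unitSeq (j + 1)) z *
        gapProd (qPochInv q) n z (tailSeq y + unitSeq j) = 0 := by
      by_contra hne
      have g1 : y (j + 2) ≤ x (j + 2) := by
        rcases Nat.lt_or_ge (j + 2) n with h | h
        · exact le_of_gapProd_ne_zero
            (left_ne_zero_of_mul (left_ne_zero_of_mul (left_ne_zero_of_mul hne))) h
        · obtain rfl : n = j + 2 := by omega
          exact hxy
      have g2 := le_of_gapProd_ne_zero
        (right_ne_zero_of_mul (left_ne_zero_of_mul (left_ne_zero_of_mul hne))) hj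
      have g3 := le_of_gapProd_ne_zero (right_ne_zero_of_mul (left_ne_zero_of_mul hne)) hj'
      have g4 := le_of_gapProd_ne_zero (right_ne_zero_of_mul hne) hj'
      simp only [tailSeq, Pi.add_apply, unitSeq_self, unitSeq_of_ne (show j ≠ j + 1 by omega),
        add_zero, show j + 1 + 1 = j + 2 from rfl] at g2 g3 g4
      omega
    have hT2 : gapProd (qPochInv q) n x (y + unitSeq (j + 1)) *
        gapProd (qPochInv q) n (y + unitSeq (j + 1)) (tailSeq x) * gapProd (qPochInv q) n y z *
        gapProd (qPochInv q) n z (tailSeq y) = 0 := by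
      by_contra hne
      have g1 := le_of_gapProd_ne_zero
        (left_ne_zero_of_mul (left_ne_zero_of_mul (left_ne_zero_of_mul hne))) hj
      have g2 := le_of_gapProd_ne_zero
        (right_ne_zero_of_mul (left_ne_zero_of_mul (left_ne_zero_of_mul hne))) hj'
      have g3 := le_of_gapProd_ne_zero (right_ne_zero_of_mul (left_ne_zero_of_mul hne)) hj
      have g4 := le_of_gapProd_ne_zero (right_ne_zero_of_mul hne) hj
      simp only [tailSeq, Pi.add_apply, unitSeq_self, unitSeq_of_ne (show j ≠ j + 1 by omega),
        add_zero, show j + 1 + 1 = j + 2 from rfl] at g1 g2 g4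
      omega
    rw [hE, hB] at hT1
    rw [hA, hC] at hT2
    rw [hE, hA, hB, hC]
    linear_combination ((1 - q ^ (y j - y (j + 1))) *
        (gapPoch q n x * gapPoch q n (y + unitSeq (j + 1)))
        - (1 - q ^ (y (j + 1) + 1 - y (j + 2))) * (gapPoch q n x * gapPoch q n y)) * (hT1 - hT2)

theorem upFactor_mul_stepWeight_lower_zero {q : ℝ} (h0 : 0 < q) (h1 : q < 1) {n : ℕ} (hn : 0 < n)
    (x y z : ℕ → ℤ) :
    upFactor q (z - unitSeq 0) 0 * stepWeight q n x y (z - unitSeq 0)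
      = (1 - q ^ (z 0 - y 1)) * (gapPoch q n x * gapPoch q n y) *
        (gapProd (qPochInv q) n x y * gapProd (qPochInv q) n y (tailSeq x) *
          gapProd (qPochInv q) n (y + unitSeq 0) z * gapProd (qPochInv q) n z (tailSeq y)) := by
  have hE := gapProd_inv_right h0 h1 z (tailSeq y) hn
  simp only [tailSeq, zero_add] at hE
  rw [stepWeight, gapProd_sub_left, gapProd_sub_right, upFactor, hE]
  ring

theorem upFactor_mul_stepWeight_lower_succ {q : ℝ} (h0 : 0 < q) (h1 : q < 1) {n j : ℕ}
    (hj : j + 1 < n) (x y z : ℕ → ℤ) :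
    upFactor q (z - unitSeq (j + 1)) (j + 1) * stepWeight q n x y (z - unitSeq (j + 1))
      = (1 - q ^ (z j - z (j + 1) + 1)) * (1 - q ^ (z (j + 1) - y (j + 2))) *
        (gapPoch q n x * gapPoch q n y) *
        (gapProd (qPochInv q) n x y * gapProd (qPochInv q) n y (tailSeq x) *
          gapProd (qPochInv q) n (y + unitSeq (j + 1)) z *
          gapProd (qPochInv q) n z (tailSeq y)) := by
  have hE := gapProd_inv_right h0 h1 z (tailSeq y) hj
  simp only [tailSeq] at hE
  rw [stepWeight, gapProd_sub_left, gapProd_sub_right, upFactor]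
  simp only [Pi.sub_apply, unitSeq_self, unitSeq_of_ne (show j ≠ j + 1 by omega)]
  rw [hE, show z j - 0 - (z (j + 1) - 1) = z j - z (j + 1) + 1 by ring]
  ring

/-- The ratio `q ^ (z_{i-1} - y_i)`, read as `0` for `i = 0`. -/
noncomputable def prevRatio (q : ℝ) (z y : ℕ → ℤ) : ℕ → ℝ
  | 0 => 0
  | j + 1 => q ^ (z j - y (j + 1))

theorem flux_add_unitSeq {q : ℝ} (h0 : 0 < q) (h1 : q < 1) {n i : ℕ} (hi : i + 1 < n)
    {x : ℕ → ℤ} (hx : Antitone x) (y z : ℕ → ℤ) (hxy : y n ≤ x n) :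
    flux q n x (y + unitSeq i) z i
      = upFactor q (z - unitSeq i) i * stepWeight q n x y (z - unitSeq i)
        - downFactor q x (i + 1) * stepWeight q n (x - unitSeq (i + 1)) y z
        + stepWeight q n x y z * ((prevRatio q z y (i + 1) - q ^ (x (i + 1) - y (i + 1)))
          - (prevRatio q z y i - q ^ (x i - y i))) := by
  have hA := gapProd_inv_right h0 h1 x y hi
  have hB := gapProd_inv_left h0 h1 y (tailSeq x) (show i < n by omega)
  have hC := gapProd_inv_left h0 h1 y z (show i < n by omega)
  simp only [tailSeq] at hB
  have t1 := zpow_three_term h0.ne' (x i) (x (i + 1)) (y (i + 1)) (y i)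
  rw [downFactor_mul_stepWeight_upper h0 h1 hi hx]
  rcases i with _ | j
  · rw [flux_add_unitSeq_zero h0 h1 (by omega) x y z hxy,
      upFactor_mul_stepWeight_lower_zero h0 h1 (by omega), stepWeight]
    simp only [prevRatio, zero_add] at *
    have t2 : (q : ℝ) ^ (y 0 + 1 - y 1) = q ^ (y 0 + 1 - z 0) * q ^ (z 0 - y 1) := by
      rw [← zpow_add₀ h0.ne']
      congr 1
      ring
    generalize gapPoch q n x * gapPoch q n y = Φ at *
    generalize gapProd (qPochInv q) n x y = A at *
    generalize gapProd (qPochInv q) n y (tailSeq x) = B at *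
    generalize gapProd (qPochInv q) n (y + unitSeq 0) (tailSeq x) = B' at *
    generalize gapProd (qPochInv q) n y z = C at *
    generalize gapProd (qPochInv q) n (y + unitSeq 0) z = C' at *
    generalize gapProd (qPochInv q) n z _ = E at *
    linear_combination (-Φ * A * B * C' * E) * t2 + (Φ * A * B' * C * E) * t1
      + Φ * A * C * E * (q ^ (x 1 - y 1) - q ^ (x 0 - y 0)) * hB
      - Φ * A * B * E * q ^ (z 0 - y 1) * hC
  · rw [flux_add_unitSeq_succ h0 h1 (by omega) x y z hxy,
      upFactor_mul_stepWeight_lower_succ h0 h1 (by omega), stepWeight]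
    have t2 := zpow_three_term h0.ne' (z j) (z (j + 1)) (y (j + 2)) (y (j + 1))
    simp only [prevRatio, show j + 1 + 1 = j + 2 from rfl] at *
    generalize gapPoch q n x * gapPoch q n y = Φ at *
    generalize gapProd (qPochInv q) n x y = A at *
    generalize gapProd (qPochInv q) n y (tailSeq x) = B at *
    generalize gapProd (qPochInv q) n (y + unitSeq (j + 1)) (tailSeq x) = B' at *
    generalize gapProd (qPochInv q) n y z = C at *
    generalize gapProd (qPochInv q) n (y + unitSeq (j + 1)) z = C' at *
    generalize gapProd (qPochInv q) n z _ = E at *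
    linear_combination (-Φ * A * B * C' * E) * t2 + (Φ * A * B' * C * E) * t1
      + Φ * A * C * E * (q ^ (x (j + 2) - y (j + 2)) - q ^ (x (j + 1) - y (j + 1))) * hB
      - Φ * A * B * E * (q ^ (z (j + 1) - y (j + 2)) - q ^ (z j - y (j + 1))) * hC

theorem flux_add_unitSeq_last {q : ℝ} (h0 : 0 < q) (h1 : q < 1) (k : ℕ)
    (x y z : ℕ → ℤ) (hxk : x (k + 1) = 0) (hyk : y (k + 1) = 0) (hzk : z k = 0) :
    flux q (k + 1) x (y + unitSeq k) z k
      = stepWeight q (k + 1) x y z * (q ^ (x k - y k) - prevRatio q z y k) := by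
  have hB := gapProd_inv_left h0 h1 y (tailSeq x) (show k < k + 1 by omega)
  have hC := gapProd_inv_left h0 h1 y z (show k < k + 1 by omega)
  simp only [tailSeq] at hB
  rw [hxk] at hB
  rw [hzk] at hC
  rw [stepWeight]
  rcases k with _ | j
  · rw [flux_add_unitSeq_zero h0 h1 (by omega) x y z (by omega)]
    simp only [prevRatio, zero_add] at *
    rw [hB, hC, hyk]
    simp only [sub_zero]
    ring
  · rw [flux_add_unitSeq_succ h0 h1 (by omega) x y z (by omega)]
    simp only [prevRatio, show j + 1 + 1 = j + 2 from rfl] at *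
    rw [hB, hC, hyk]
    simp only [sub_zero]
    ring

theorem sum_flux_add_unitSeq {q : ℝ} (h0 : 0 < q) (h1 : q < 1) (k : ℕ) {x : ℕ → ℤ}
    (hx : Antitone x) (y z : ℕ → ℤ) (hxk : x (k + 1) = 0) (hyk : y (k + 1) = 0)
    (hzk : z k = 0) :
    ∑ i ∈ Finset.range (k + 1), flux q (k + 1) x (y + unitSeq i) z i
      = stepWeight q (k + 1) x y z
        + ∑ i ∈ Finset.range k,
          upFactor q (z - unitSeq i) i * stepWeight q (k + 1) x y (z - unitSeq i)
        - ∑ i ∈ Finset.range (k + 1),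
          downFactor q x i * stepWeight q (k + 1) (x - unitSeq i) y z := by
  have key : ∀ j ∈ Finset.range k, flux q (k + 1) x (y + unitSeq j) z j = _ := fun j hj =>
    flux_add_unitSeq h0 h1 (by simpa using hj) hx y z (by omega)
  rw [Finset.sum_range_succ, Finset.sum_congr rfl key, Finset.sum_add_distrib,
    Finset.sum_sub_distrib, ← Finset.mul_sum,
    Finset.sum_range_sub (fun i => prevRatio q z y i - (q : ℝ) ^ (x i - y i)),
    flux_add_unitSeq_last h0 h1 k x y z hxk hyk hzk, Finset.sum_range_succ' (n := k),
    downFactor_mul_stepWeight_upper_zero h0 h1 k.succ_pos hx]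
  simp only [prevRatio]
  ring

/-! ### Partitions as integer sequences, and sums over boxes -/

/-- A finitely supported sequence of natural numbers as an integer sequence. -/
def toSeq (l : ℕ →₀ ℕ) : ℕ → ℤ := fun i => l i

/-- The sequences supported on the first `n` rows whose terms are at most `M`. -/
noncomputable def box (n M : ℕ) : Finset (ℕ →₀ ℕ) :=
  Finset.finsupp (Finset.range n) fun _ => Finset.range (M + 1)

theorem mem_box {n M : ℕ} {l : ℕ →₀ ℕ} :
    l ∈ box n M ↔ (∀ i, n ≤ i → l i = 0) ∧ ∀ i, i < n → l i ≤ M := by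
  simp only [box, Finset.mem_finsupp_iff, Finset.subset_iff, Finsupp.mem_support_iff,
    Finset.mem_range, Nat.lt_succ_iff]
  refine and_congr_left fun _ => ⟨fun h i hi => ?_, fun h i hi => ?_⟩
  · by_contra h'
    exact absurd (h h') (by omega)
  · by_contra h'
    exact hi (h i (by omega))

theorem e_self (i : ℕ) : e i i = 1 := by simp [e]

theorem e_of_ne {i j : ℕ} (h : j ≠ i) : e i j = 0 := by simp [e, h]

theorem degree_e (i : ℕ) : (e i).degree = 1 := by simp [e]

theorem sub_e_add_e {l : ℕ →₀ ℕ} {i : ℕ} (h : 1 ≤ l i) : l - e i + e i = l := by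
  ext j
  rcases eq_or_ne j i with rfl | hj
  · simp [e_self]; omega
  · simp [e_of_ne hj]

theorem toSeq_add_e (l : ℕ →₀ ℕ) (i : ℕ) : toSeq (l + e i) = toSeq l + unitSeq i := by
  funext j
  rcases eq_or_ne j i with rfl | hj
  · simp [toSeq, e_self, unitSeq_self]
  · simp [toSeq, e_of_ne hj, unitSeq_of_ne hj]

theorem toSeq_sub_e {l : ℕ →₀ ℕ} {i : ℕ} (h : 1 ≤ l i) :
    toSeq (l - e i) = toSeq l - unitSeq i := by
  rw [eq_sub_iff_add_eq, ← toSeq_add_e, sub_e_add_e h]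

theorem degree_add_e (l : ℕ →₀ ℕ) (i : ℕ) : ((l + e i).degree : ℤ) = l.degree + 1 := by
  rw [map_add, degree_e]
  push_cast
  rfl

theorem degree_sub_e {l : ℕ →₀ ℕ} {i : ℕ} (h : 1 ≤ l i) :
    ((l - e i).degree : ℤ) = l.degree - 1 := by
  rw [eq_sub_iff_add_eq, ← degree_add_e, sub_e_add_e h]

theorem mem_Lam_iff {n : ℕ} {l : ℕ →₀ ℕ} : l ∈ Lam n ↔ Antitone l ∧ ∀ i, n ≤ i → l i = 0 := by
  refine ⟨fun h => ⟨h.1, fun i hi => Lam.eq_zero h hi⟩, fun h => ⟨h.1, ?_⟩⟩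
  have : l.support ⊆ Finset.range n := by
    intro i hi
    by_contra h'
    exact Finsupp.mem_support_iff.1 hi (h.2 i (by simpa using h'))
  simpa using Finset.card_le_card this

theorem Lam.antitone_toSeq {n : ℕ} {l : ℕ →₀ ℕ} (h : l ∈ Lam n) : Antitone (toSeq l) :=
  fun _ _ hij => Int.ofNat_le.2 (h.1 hij)

theorem Lam.mem_box {n M : ℕ} {l : ℕ →₀ ℕ} (h : l ∈ Lam n) (hM : l 0 ≤ M) : l ∈ box n M :=
  QBerele.mem_box.2 ⟨fun _ hi => Lam.eq_zero h hi, fun i _ => (h.1 (Nat.zero_le i)).trans hM⟩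

theorem Lam.add_e_mem {n i : ℕ} {l : ℕ →₀ ℕ} (h : l ∈ Lam n) (hi : i < n)
    (hlt : i = 0 ∨ l i < l (i - 1)) : l + e i ∈ Lam n := by
  rw [mem_Lam_iff]
  refine ⟨antitone_nat_of_succ_le fun j => ?_, fun j hj => ?_⟩
  · have := h.1 (Nat.le_succ j)
    simp only [Finsupp.add_apply]
    rcases eq_or_ne j i with rfl | hj
    · rw [e_self, e_of_ne (by omega)]
      simp only [Nat.succ_eq_add_one] at this
      omega
    · rw [e_of_ne hj]
      rcases eq_or_ne (j + 1) i with rfl | hj'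
      · rw [e_self]
        simp only [Nat.add_sub_cancel] at hlt
        omega
      · rw [e_of_ne hj']
        simpa using this
  · rw [Finsupp.add_apply, Lam.eq_zero h hj, e_of_ne (by omega)]

theorem Lam.sub_e_mem {n i : ℕ} {l : ℕ →₀ ℕ} (h : l ∈ Lam n) (hlt : l (i + 1) < l i) :
    l - e i ∈ Lam n := by
  rw [mem_Lam_iff]
  refine ⟨antitone_nat_of_succ_le fun j => ?_, fun j hj => ?_⟩
  · have := h.1 (Nat.le_succ j)
    simp only [Finsupp.tsub_apply]
    rcases eq_or_ne j i with rfl | hj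
    · rw [e_self, e_of_ne (by omega)]
      omega
    · rw [e_of_ne hj]
      simp only [Nat.succ_eq_add_one] at this
      omega
  · rw [Finsupp.tsub_apply, Lam.eq_zero h hj, Nat.zero_sub]

theorem uPlus_eq_upFactor {n : ℕ} {l : ℕ →₀ ℕ} (h : l ∈ Lam n) (q : ℝ) (i : ℕ) :
    uPlus q l i = upFactor q (toSeq l) i := by
  rcases i with _ | j
  · rfl
  · have := h.1 (Nat.le_succ j)
    simp only [Nat.succ_eq_add_one] at this
    simp only [uPlus, upFactor, toSeq, Nat.succ_ne_zero, if_false, Nat.add_sub_cancel]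
    rw [← zpow_natCast, Nat.cast_sub this]

theorem uMinus_eq_downFactor {n : ℕ} {l : ℕ →₀ ℕ} {i : ℕ} (h : l (i + 1) ≤ l i)
    (hn : l n = 0) (hi : i < n) (q : ℝ) : uMinus n q l i = downFactor q (toSeq l) i := by
  have : (q : ℝ) ^ (l i - l (i + 1)) = q ^ ((l i : ℤ) - l (i + 1)) := by
    rw [← zpow_natCast, Nat.cast_sub h]
  unfold uMinus downFactor toSeq
  split_ifs with h'
  · rw [this]
  · obtain rfl : n = i + 1 := by omega
    rw [← this, hn, Nat.sub_zero]

/-- Translation by `e_i` does not change the sum over a large box of a function that vanishes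
where row `i` is empty or long. -/
theorem sum_box_add_e {n M i : ℕ} (hi : i < n) (f : (ℕ →₀ ℕ) → ℝ)
    (hzero : ∀ l ∈ box n M, l i = 0 → f l = 0)
    (hlarge : ∀ l, l i = M + 1 → f l = 0) :
    ∑ l ∈ box n M, f (l + e i) = ∑ l ∈ box n M, f l := by
  rw [← Finset.sum_filter_of_ne (p := fun l => l i < M) (f := fun l => f (l + e i))]
  · refine Finset.sum_of_injOn (fun l => l + e i) (fun _ _ _ _ h => add_right_cancel h) ?_ ?_
      fun _ _ => rfl
    · intro l hl
      obtain ⟨hl, hlt⟩ := Finset.mem_filter.1 hl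
      rw [mem_box] at hl
      refine mem_box.2 ⟨fun j hj => ?_, fun j hj => ?_⟩
      · simp [hl.1 j hj, e_of_ne (show j ≠ i by omega)]
      · rcases eq_or_ne j i with rfl | hne
        · simp [e_self]; omega
        · simp [e_of_ne hne, hl.2 j hj]
    · intro l hl hnot
      refine hzero l hl ?_
      by_contra hne
      refine hnot ⟨l - e i, ?_, sub_e_add_e (by omega)⟩
      rw [mem_box] at hl
      refine Finset.mem_filter.2 ⟨mem_box.2 ⟨fun j hj => ?_, fun j hj => ?_⟩, ?_⟩
      · simp [hl.1 j hj]
      · have := hl.2 j hj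
        simp
        omega
      · have := hl.2 i hi
        simp [e_self]
        omega
  · intro l hl hne
    have := (mem_box.1 hl).2 i hi
    by_contra h'
    exact hne (hlarge _ (by simp [e_self]; omega))

/-! ### Vanishing of the branching weight -/

theorem stepWeight_ne_zero {q : ℝ} {n : ℕ} {x y z : ℕ → ℤ} (h : stepWeight q n x y z ≠ 0)
    {i : ℕ} (hi : i < n) : y i ≤ x i ∧ x (i + 1) ≤ y i ∧ z i ≤ y i ∧ y (i + 1) ≤ z i := by
  have h' := right_ne_zero_of_mul h
  exact ⟨le_of_gapProd_ne_zero
      (left_ne_zero_of_mul (left_ne_zero_of_mul (left_ne_zero_of_mul h'))) hi,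
    le_of_gapProd_ne_zero (right_ne_zero_of_mul (left_ne_zero_of_mul (left_ne_zero_of_mul h'))) hi,
    le_of_gapProd_ne_zero (right_ne_zero_of_mul (left_ne_zero_of_mul h')) hi,
    le_of_gapProd_ne_zero (right_ne_zero_of_mul h') hi⟩

theorem flux_eq_zero_of_eq_zero {q : ℝ} {n : ℕ} {x y z : ℕ → ℤ} (hx : ∀ i, 0 ≤ x i)
    (hz : ∀ i, 0 ≤ z i) {i : ℕ} (hi : i < n) (hy : y i = 0) : flux q n x y z i = 0 := by
  have h1 : (1 - q ^ (y i - x (i + 1))) * gapProd (qPochInv q) n y (tailSeq x) = 0 := by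
    rcases (hx (i + 1)).eq_or_lt with h | h
    · simp [hy, ← h]
    · rw [gapProd_eq_zero hi (by simpa [tailSeq, hy] using h), mul_zero]
  have h2 : (1 - q ^ (y i - z i)) * gapProd (qPochInv q) n y z = 0 := by
    rcases (hz i).eq_or_lt with h | h
    · simp [hy, ← h]
    · rw [gapProd_eq_zero hi (by simpa [hy] using h), mul_zero]
  rcases i with _ | j
  · rw [flux]
    linear_combination gapPoch q n x * gapPoch q n y * gapProd (qPochInv q) n z (tailSeq y) *
      (gapProd (qPochInv q) n (x + unitSeq 0) y * gapProd (qPochInv q) n y z * h1 -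
        gapProd (qPochInv q) n x y * gapProd (qPochInv q) n y (tailSeq x) * h2)
  · rw [flux]
    linear_combination (1 - q ^ (y j - y (j + 1) + 1)) * (gapPoch q n x * gapPoch q n y) *
      (gapProd (qPochInv q) n (x + unitSeq (j + 1)) y * gapProd (qPochInv q) n y z *
          gapProd (qPochInv q) n z (tailSeq y) * h1 -
        gapProd (qPochInv q) n x y * gapProd (qPochInv q) n y (tailSeq x) *
          gapProd (qPochInv q) n (z + unitSeq j) (tailSeq y) * h2)

theorem flux_eq_zero_of_lt {q : ℝ} {n : ℕ} {x y z : ℕ → ℤ} {i : ℕ} (hi : i < n)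
    (hy : x i + 1 < y i) : flux q n x y z i = 0 := by
  have h1 : gapProd (qPochInv q) n (x + unitSeq i) y = 0 :=
    gapProd_eq_zero hi (by simpa [unitSeq_self] using hy)
  have h2 : gapProd (qPochInv q) n x y = 0 := gapProd_eq_zero hi (by omega)
  rcases i with _ | j <;> simp [flux, h1, h2]

/-! ### The branching identity -/

/-- The exponent `2|v| - |l| - |u|` of the variable that belongs to two consecutive steps
`u ≼ v ≼ l` of a pattern. -/
noncomputable def stepExp (l v u : ℕ →₀ ℕ) : ℤ := 2 * (v.degree : ℤ) - l.degree - u.degree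

theorem sum_stepWeight {q a : ℝ} (h0 : 0 < q) (h1 : q < 1) (ha : a ≠ 0) {k M : ℕ}
    {l u : ℕ →₀ ℕ} (hl : l ∈ Lam (k + 1)) (hu : u ∈ Lam k) (hM : l 0 + 1 ≤ M) :
    ∑ v ∈ box (k + 1) M,
      (a ^ (stepExp l v u - 1) * ∑ i ∈ Finset.range (k + 1),
          upFactor q (toSeq l) i * stepWeight q (k + 1) (toSeq l + unitSeq i) (toSeq v) (toSeq u)
        + a ^ (stepExp l v u + 1) * ∑ i ∈ Finset.range (k + 1),
          downFactor q (toSeq l) i *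
            stepWeight q (k + 1) (toSeq l - unitSeq i) (toSeq v) (toSeq u))
      = ∑ v ∈ box (k + 1) M,
        ((a + a⁻¹) * (a ^ stepExp l v u * stepWeight q (k + 1) (toSeq l) (toSeq v) (toSeq u))
          + a ^ (stepExp l v u + 1) * ∑ i ∈ Finset.range k, upFactor q (toSeq u - unitSeq i) i *
            stepWeight q (k + 1) (toSeq l) (toSeq v) (toSeq u - unitSeq i)
          + a ^ (stepExp l v u - 1) * ∑ i ∈ Finset.range k,
            downFactor q (toSeq u + unitSeq i) i *
              stepWeight q (k + 1) (toSeq l) (toSeq v) (toSeq u + unitSeq i)) := by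
  have hx := Lam.antitone_toSeq hl
  have hxk : toSeq l (k + 1) = 0 := by simp [toSeq, Lam.eq_zero hl le_rfl]
  have hzk : toSeq u k = 0 := by simp [toSeq, Lam.eq_zero hu le_rfl]
  -- Both sides reduce to the total flux, at `v` and at the translates of `v`.
  have key : ∑ v ∈ box (k + 1) M, a ^ (stepExp l v u - 1) *
        ∑ i ∈ Finset.range (k + 1), flux q (k + 1) (toSeq l) (toSeq v) (toSeq u) i
      = ∑ v ∈ box (k + 1) M, a ^ (stepExp l v u + 1) *
        ∑ i ∈ Finset.range (k + 1),
          flux q (k + 1) (toSeq l) (toSeq v + unitSeq i) (toSeq u) i := by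
    simp only [Finset.mul_sum]
    rw [Finset.sum_comm, Finset.sum_comm (t := Finset.range (k + 1))]
    refine Finset.sum_congr rfl fun i hi => ?_
    have hi := Finset.mem_range.1 hi
    rw [← sum_box_add_e hi]
    · refine Finset.sum_congr rfl fun v _ => ?_
      rw [toSeq_add_e]
      congr 2
      unfold stepExp
      rw [degree_add_e]
      ring
    · intro v _ hv
      rw [flux_eq_zero_of_eq_zero (x := toSeq l) (z := toSeq u) (fun _ => Int.natCast_nonneg _)
        (fun _ => Int.natCast_nonneg _) hi (by simp [toSeq, hv]), mul_zero]
    · intro v hv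
      rw [flux_eq_zero_of_lt hi, mul_zero]
      have := hl.1 (Nat.zero_le i)
      simp only [toSeq, hv]
      omega
  rw [← sub_eq_zero] at key ⊢
  rw [← Finset.sum_sub_distrib] at key ⊢
  rw [← key]
  refine Finset.sum_congr rfl fun v hv => ?_
  rw [sum_flux h0 h1 k hx _ _ hxk hzk, sum_flux_add_unitSeq h0 h1 k hx _ _ hxk
    (by simp [toSeq, (mem_box.1 hv).1 (k + 1) le_rfl]) hzk, zpow_add_one₀ ha, zpow_sub_one₀ ha]
  ring

/-! ### From level `k` to level `k + 1` of the eigenfunction equation -/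

/-- The action on functions of partitions of the kernel `L_n`. -/
noncomputable def kernelSum (n : ℕ) (q : ℝ) (P : (ℕ →₀ ℕ) → ℝ) (l : ℕ →₀ ℕ) : ℝ :=
  ∑ i ∈ Finset.range n,
    (uPlus q l i * P (l + e i) + if 1 ≤ l i then uMinus n q l i * P (l - e i) else 0)

theorem stepWeight_eq_zero_of_notMem {q : ℝ} {k M : ℕ} {l v u : ℕ →₀ ℕ} (hu : u ∈ box k M)
    (h : u ∉ Lam k) : stepWeight q (k + 1) (toSeq l) (toSeq v) (toSeq u) = 0 := by
  by_contra hne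
  refine h (mem_Lam_iff.2 ⟨antitone_nat_of_succ_le fun j => ?_, (mem_box.1 hu).1⟩)
  rcases Nat.lt_or_ge (j + 1) k with hj | hj
  · have g1 := (stepWeight_ne_zero hne (show j < k + 1 by omega)).2.2.2
    have g2 := (stepWeight_ne_zero hne (show j + 1 < k + 1 by omega)).2.2.1
    simp only [toSeq] at g1 g2
    omega
  · simp [(mem_box.1 hu).1 _ hj]

/-- The transpose of the kernel `L_k` acts on the lower row of the branching weight. -/
theorem sum_stepWeight_mul_kernelSum {q a : ℝ} {k M : ℕ}
    {l v : ℕ →₀ ℕ} (hl : l ∈ Lam (k + 1)) (hM : l 0 + 1 ≤ M) {P : (ℕ →₀ ℕ) → ℝ}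
    (hP : ∀ u, u ∉ Lam k → P u = 0) :
    ∑ u ∈ box k M, a ^ stepExp l v u * stepWeight q (k + 1) (toSeq l) (toSeq v) (toSeq u) *
        kernelSum k q P u
      = ∑ u ∈ box k M, P u *
        (a ^ (stepExp l v u + 1) * ∑ i ∈ Finset.range k, upFactor q (toSeq u - unitSeq i) i *
            stepWeight q (k + 1) (toSeq l) (toSeq v) (toSeq u - unitSeq i)
          + a ^ (stepExp l v u - 1) * ∑ i ∈ Finset.range k,
            downFactor q (toSeq u + unitSeq i) i *
              stepWeight q (k + 1) (toSeq l) (toSeq v) (toSeq u + unitSeq i)) := by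
  simp only [kernelSum, Finset.mul_sum, mul_add, Finset.sum_add_distrib]
  congr 1
  · rw [Finset.sum_comm, Finset.sum_comm (t := Finset.range k)]
    refine Finset.sum_congr rfl fun i hi => ?_
    have hi := Finset.mem_range.1 hi
    rw [← sum_box_add_e hi (fun u => P u * (a ^ (stepExp l v u + 1) *
      (upFactor q (toSeq u - unitSeq i) i *
        stepWeight q (k + 1) (toSeq l) (toSeq v) (toSeq u - unitSeq i))))]
    · refine Finset.sum_congr rfl fun u hu => ?_
      rw [toSeq_add_e, add_sub_cancel_right]
      by_cases huk : u ∈ Lam k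
      · rw [uPlus_eq_upFactor huk, show stepExp l v (u + e i) + 1 = stepExp l v u by
          unfold stepExp; rw [degree_add_e]; ring]
        ring
      · rw [stepWeight_eq_zero_of_notMem hu huk]
        ring
    · intro u _ hui
      have : stepWeight q (k + 1) (toSeq l) (toSeq v) (toSeq u - unitSeq i) = 0 := by
        by_contra hne
        have := (stepWeight_ne_zero hne (show i < k + 1 by omega)).2.2.2
        simp only [toSeq, Pi.sub_apply, unitSeq_self, hui] at this
        omega
      rw [this]
      ring
    · intro u hui
      have : stepWeight q (k + 1) (toSeq l) (toSeq v) (toSeq u - unitSeq i) = 0 := by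
        by_contra hne
        have := stepWeight_ne_zero hne (show i < k + 1 by omega)
        have h2 := hl.1 (Nat.zero_le i)
        simp only [toSeq, Pi.sub_apply, unitSeq_self, hui] at this
        omega
      rw [this]
      ring
  · rw [Finset.sum_comm, Finset.sum_comm (t := Finset.range k)]
    refine Finset.sum_congr rfl fun i hi => ?_
    have hi := Finset.mem_range.1 hi
    rw [← sum_box_add_e hi (fun u => a ^ stepExp l v u *
      stepWeight q (k + 1) (toSeq l) (toSeq v) (toSeq u) *
        if 1 ≤ u i then uMinus k q u i * P (u - e i) else 0)]
    · refine Finset.sum_congr rfl fun u hu => ?_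
      have hui : 1 ≤ (u + e i) i := by simp [e_self]
      rw [if_pos hui, add_tsub_cancel_right]
      by_cases huk : u ∈ Lam k
      · have h2 := huk.1 (Nat.le_succ i)
        rw [uMinus_eq_downFactor, toSeq_add_e, show stepExp l v (u + e i) = stepExp l v u - 1 by
          unfold stepExp; rw [degree_add_e]; ring]
        · ring
        · simp only [Finsupp.add_apply, e_self, e_of_ne (show i + 1 ≠ i by omega)]
          simp only [Nat.succ_eq_add_one] at h2
          omega
        · simp [Lam.eq_zero huk le_rfl, e_of_ne (show k ≠ i by omega)]
        · exact hi
      · rw [hP u huk]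
        ring
    · intro u _ hui
      simp [hui]
    · intro u hui
      have : stepWeight q (k + 1) (toSeq l) (toSeq v) (toSeq u) = 0 := by
        by_contra hne
        have := stepWeight_ne_zero hne (show i < k + 1 by omega)
        have h2 := hl.1 (Nat.zero_le i)
        simp only [toSeq, hui] at this
        omega
      rw [this]
      ring

/-- If `P` is an eigenfunction of `L_k` with eigenvalue `s`, then the function `P'` obtained from
it by branching is an eigenfunction of `L_{k+1}` with eigenvalue `s + a + a⁻¹`. -/
theorem kernelSum_succ {q a s : ℝ} (h0 : 0 < q) (h1 : q < 1) (ha : a ≠ 0) {k : ℕ}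
    {P P' : (ℕ →₀ ℕ) → ℝ} (hP : ∀ u, u ∉ Lam k → P u = 0)
    (hrec : ∀ l ∈ Lam (k + 1), ∀ M, l 0 ≤ M → P' l = ∑ u ∈ box k M, ∑ v ∈ box (k + 1) M,
      a ^ stepExp l v u * stepWeight q (k + 1) (toSeq l) (toSeq v) (toSeq u) * P u)
    (heig : ∀ u ∈ Lam k, kernelSum k q P u = s * P u) {l : ℕ →₀ ℕ} (hl : l ∈ Lam (k + 1)) :
    kernelSum (k + 1) q P' l = (s + (a + a⁻¹)) * P' l := by
  have hplus : ∀ i ∈ Finset.range (k + 1), uPlus q l i * P' (l + e i)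
      = ∑ u ∈ box k (l 0 + 1), ∑ v ∈ box (k + 1) (l 0 + 1), P u * (a ^ (stepExp l v u - 1) *
        (upFactor q (toSeq l) i *
          stepWeight q (k + 1) (toSeq l + unitSeq i) (toSeq v) (toSeq u))) := by
    intro i hi
    have hi := Finset.mem_range.1 hi
    rw [uPlus_eq_upFactor hl]
    by_cases hlt : i = 0 ∨ l i < l (i - 1)
    · rw [hrec _ (Lam.add_e_mem hl hi hlt) (l 0 + 1), Finset.mul_sum]
      · refine Finset.sum_congr rfl fun u _ => ?_
        rw [Finset.mul_sum]
        refine Finset.sum_congr rfl fun v _ => ?_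
        rw [toSeq_add_e, show stepExp (l + e i) v u = stepExp l v u - 1 by
          unfold stepExp; rw [degree_add_e]; ring]
        ring
      · have : e i 0 ≤ 1 := by unfold e; rw [Finsupp.single_apply]; split_ifs <;> omega
        simp only [Finsupp.add_apply]
        omega
    · have : upFactor q (toSeq l) i = 0 := by
        obtain ⟨j, rfl⟩ : ∃ j, i = j + 1 := ⟨i - 1, by omega⟩
        have h2 := hl.1 (Nat.le_succ j)
        have : l j = l (j + 1) := by
          simp only [Nat.succ_eq_add_one, Nat.add_sub_cancel] at h2 hlt
          omega
        simp [upFactor, toSeq, this]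
      simp [this]
  have hminus : ∀ i ∈ Finset.range (k + 1),
      (if 1 ≤ l i then uMinus (k + 1) q l i * P' (l - e i) else 0)
      = ∑ u ∈ box k (l 0 + 1), ∑ v ∈ box (k + 1) (l 0 + 1), P u * (a ^ (stepExp l v u + 1) *
        (downFactor q (toSeq l) i *
          stepWeight q (k + 1) (toSeq l - unitSeq i) (toSeq v) (toSeq u))) := by
    intro i hi
    have hi := Finset.mem_range.1 hi
    have h2 := hl.1 (Nat.le_succ i)
    simp only [Nat.succ_eq_add_one] at h2
    by_cases hlt : l (i + 1) < l i
    · rw [if_pos (by omega), uMinus_eq_downFactor h2 (Lam.eq_zero hl le_rfl) hi,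
        hrec _ (Lam.sub_e_mem hl hlt) (l 0 + 1), Finset.mul_sum]
      · refine Finset.sum_congr rfl fun u _ => ?_
        rw [Finset.mul_sum]
        refine Finset.sum_congr rfl fun v _ => ?_
        rw [toSeq_sub_e (by omega), show stepExp (l - e i) v u = stepExp l v u + 1 by
          unfold stepExp; rw [degree_sub_e (by omega)]; ring]
        ring
      · simp only [Finsupp.tsub_apply]
        omega
    · have hd : downFactor q (toSeq l) i = 0 := by
        have : l i = l (i + 1) := by omega
        simp [downFactor, toSeq, this]
      rw [uMinus_eq_downFactor h2 (Lam.eq_zero hl le_rfl) hi, hd]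
      simp
  have hs : s * P' l = ∑ u ∈ box k (l 0 + 1), ∑ v ∈ box (k + 1) (l 0 + 1), P u *
        (a ^ (stepExp l v u + 1) * ∑ i ∈ Finset.range k, upFactor q (toSeq u - unitSeq i) i *
            stepWeight q (k + 1) (toSeq l) (toSeq v) (toSeq u - unitSeq i)
          + a ^ (stepExp l v u - 1) * ∑ i ∈ Finset.range k,
            downFactor q (toSeq u + unitSeq i) i *
              stepWeight q (k + 1) (toSeq l) (toSeq v) (toSeq u + unitSeq i)) := by
    rw [hrec l hl (l 0 + 1) (Nat.le_succ _), Finset.sum_comm,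
      Finset.sum_comm (s := box k (l 0 + 1)), Finset.mul_sum]
    refine Finset.sum_congr rfl fun v _ => ?_
    rw [← sum_stepWeight_mul_kernelSum hl le_rfl hP, Finset.mul_sum]
    refine Finset.sum_congr rfl fun u hu => ?_
    by_cases huk : u ∈ Lam k
    · rw [heig u huk]
      ring
    · rw [stepWeight_eq_zero_of_notMem hu huk]
      ring
  rw [add_mul, hs, hrec l hl (l 0 + 1) (Nat.le_succ _), kernelSum, Finset.sum_add_distrib,
    Finset.sum_congr rfl hplus, Finset.sum_congr rfl hminus,
    Finset.sum_comm (s := Finset.range (k + 1)), Finset.sum_comm (s := Finset.range (k + 1)),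
    ← Finset.sum_add_distrib, Finset.mul_sum, ← Finset.sum_add_distrib]
  refine Finset.sum_congr rfl fun u _ => ?_
  by_cases huk : u ∈ Lam k
  · have := congrArg (P u * ·) (sum_stepWeight h0 h1 ha hl huk (le_refl (l 0 + 1)))
    simp only [Finset.mul_sum (s := box (k + 1) (l 0 + 1))] at this
    rw [Finset.sum_comm (s := Finset.range (k + 1)), Finset.sum_comm (s := Finset.range (k + 1)),
      ← Finset.sum_add_distrib, Finset.mul_sum, ← Finset.sum_add_distrib]
    refine Eq.trans ?_ (this.trans ?_)
    · refine Finset.sum_congr rfl fun v _ => ?_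
      simp only [Finset.mul_sum, mul_add]
    · refine Finset.sum_congr rfl fun v _ => ?_
      ring
  · simp [hP u huk]

/-! ### Branching of the `q`-deformed symplectic functions -/

theorem qBinom_eq_qPoch {q : ℝ} (h1 : q < 1) {N k : ℕ} (hk : k ≤ N) :
    qBinom q N k = qPoch q N * (qPoch q k)⁻¹ * (qPoch q (N - k))⁻¹ := by
  have hne : (1 - q) ≠ 0 := by linarith
  obtain ⟨d, rfl⟩ := Nat.exists_eq_add_of_le hk
  rw [qBinom, qFact, qFact, qFact, Nat.add_sub_cancel_left, pow_add]
  field_simp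

theorem qBinom_sub_sub {q : ℝ} (h1 : q < 1) {a b c : ℕ} (hab : b ≤ a) (hbc : c ≤ b) :
    qBinom q (a - c) (a - b)
      = qPochInt q ((a : ℤ) - c) * qPochInv q ((a : ℤ) - b) * qPochInv q ((b : ℤ) - c) := by
  rw [qBinom_eq_qPoch h1 (by omega), qPochInt, qPochInv, qPochInv, if_pos (by omega),
    if_pos (by omega), show a - c - (a - b) = b - c by omega,
    show ((a : ℤ) - c).toNat = a - c by omega, show ((a : ℤ) - b).toNat = a - b by omega,
    show ((b : ℤ) - c).toNat = b - c by omega]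

theorem Interlaces.mem_Lam {n : ℕ} {v l : ℕ →₀ ℕ} {u : ℕ →₀ ℕ} (huv : Interlaces u v)
    (hvl : Interlaces v l) (hl : l ∈ Lam n) : v ∈ Lam n := by
  refine mem_Lam_iff.2 ⟨antitone_nat_of_succ_le fun i => (huv i).2.trans (huv i).1,
    fun i hi => ?_⟩
  have := (hvl i).1
  rw [Lam.eq_zero hl hi] at this
  omega

theorem stepWeight_eq_prod_qBinom {q : ℝ} (h0 : 0 < q) (h1 : q < 1) {k : ℕ} {l v u : ℕ →₀ ℕ}
    (hl : l ∈ Lam (k + 1)) (hu : u ∈ Lam k) (huv : Interlaces u v) (hvl : Interlaces v l) :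
    stepWeight q (k + 1) (toSeq l) (toSeq v) (toSeq u)
      = (∏ i ∈ Finset.range k,
        (qBinom q (v i - v (i + 1)) (v i - u i) * qBinom q (l i - l (i + 1)) (l i - v i))) *
          qBinom q (l k) (l k - v k) := by
  have hv := huv.mem_Lam hvl hl
  have hprod : stepWeight q (k + 1) (toSeq l) (toSeq v) (toSeq u)
      = ∏ i ∈ Finset.range (k + 1),
        (qPochInt q ((v i : ℤ) - v (i + 1)) * qPochInv q ((v i : ℤ) - u i) *
            qPochInv q ((u i : ℤ) - v (i + 1)) *
          (qPochInt q ((l i : ℤ) - l (i + 1)) * qPochInv q ((l i : ℤ) - v i) *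
            qPochInv q ((v i : ℤ) - l (i + 1)))) := by
    simp only [Finset.prod_mul_distrib, stepWeight, gapPoch, gapProd, toSeq, tailSeq]
    ring
  have hb : ∀ i, qPochInt q ((v i : ℤ) - v (i + 1)) * qPochInv q ((v i : ℤ) - u i) *
            qPochInv q ((u i : ℤ) - v (i + 1)) *
          (qPochInt q ((l i : ℤ) - l (i + 1)) * qPochInv q ((l i : ℤ) - v i) *
            qPochInv q ((v i : ℤ) - l (i + 1)))
      = qBinom q (v i - v (i + 1)) (v i - u i) * qBinom q (l i - l (i + 1)) (l i - v i) := by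
    intro i
    rw [qBinom_sub_sub h1 (huv i).1 (huv i).2, qBinom_sub_sub h1 (hvl i).1 (hvl i).2]
  rw [hprod, Finset.prod_range_succ, Finset.prod_congr rfl fun i _ => hb i, hb k,
    Lam.eq_zero hv le_rfl, Lam.eq_zero hl le_rfl, Lam.eq_zero hu le_rfl]
  have h2 : qBinom q (v k - 0) (v k - 0) = 1 := by
    have := qPoch_ne_zero h0 h1 (v k)
    rw [qBinom_eq_qPoch h1 le_rfl, Nat.sub_zero, Nat.sub_self, mul_inv_cancel₀ this]
    simp [qPoch]
  rw [h2, one_mul, Nat.sub_zero]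

theorem mem_Lam_of_mem_gtSet {n : ℕ} {l : ℕ →₀ ℕ} {Z : ℕ → ℕ →₀ ℕ} (hZ : Z ∈ gtSet n l) {j : ℕ}
    (hj : j ≤ 2 * n) : Z j ∈ Lam ((j + 1) / 2) := by
  rcases Nat.eq_zero_or_pos j with rfl | h
  · rw [hZ.2.2.1]
    exact mem_Lam_iff.2 ⟨antitone_const, fun _ _ => rfl⟩
  · exact hZ.1 j h hj

theorem interlaces_of_mem_gtSet {n : ℕ} {l : ℕ →₀ ℕ} {Z : ℕ → ℕ →₀ ℕ} (hZ : Z ∈ gtSet n l)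
    {j : ℕ} (hj : j < 2 * n) : Interlaces (Z j) (Z (j + 1)) := by
  rcases Nat.eq_zero_or_pos j with rfl | h
  · have h1 := mem_Lam_of_mem_gtSet hZ (show 1 ≤ 2 * n by omega)
    intro i
    rw [hZ.2.2.1]
    exact ⟨by simp, (Lam.eq_zero h1 (by omega)).le⟩
  · exact hZ.2.1 j h hj

theorem le_of_mem_gtSet {n : ℕ} {l : ℕ →₀ ℕ} {Z : ℕ → ℕ →₀ ℕ} (hZ : Z ∈ gtSet n l)
    {j m : ℕ} (hjm : j ≤ m) (hm : m ≤ 2 * n) (i : ℕ) : Z j i ≤ Z m i := by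
  induction m, hjm using Nat.le_induction with
  | base => exact le_rfl
  | succ m h ih =>
    exact (ih (by omega)).trans (interlaces_of_mem_gtSet hZ (show m < 2 * n by omega) i).1

/-- The restriction of a pattern to its levels up to `j`. -/
def truncPattern (j : ℕ) (Z : ℕ → ℕ →₀ ℕ) : ℕ → ℕ →₀ ℕ := fun i => if i ≤ j then Z i else 0

theorem truncPattern_mem_gtSet {k : ℕ} {l : ℕ →₀ ℕ} {Z : ℕ → ℕ →₀ ℕ} (hZ : Z ∈ gtSet (k + 1) l) :
    truncPattern (2 * k) Z ∈ gtSet k (Z (2 * k)) := by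
  refine ⟨fun j h1 h2 => ?_, fun j h1 h2 => ?_, ?_, fun j h1 => ?_, ?_⟩
  · simpa [truncPattern, h2] using hZ.1 j h1 (by omega)
  · simpa [truncPattern, h2.le, show j + 1 ≤ 2 * k by omega] using hZ.2.1 j h1 (by omega)
  · simpa [truncPattern] using hZ.2.2.1
  · simp [truncPattern, show ¬ j ≤ 2 * k by omega]
  · simp [truncPattern]

/-- The pattern `Z` of height `2k` with the levels `v` and `l` added. -/
def extendPattern (k : ℕ) (v l : ℕ →₀ ℕ) (Z : ℕ → ℕ →₀ ℕ) : ℕ → ℕ →₀ ℕ :=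
  fun j => if j ≤ 2 * k then Z j else if j = 2 * k + 1 then v else if j = 2 * k + 2 then l else 0

theorem extendPattern_mem_gtSet {k : ℕ} {u v l : ℕ →₀ ℕ} {Z : ℕ → ℕ →₀ ℕ} (hZ : Z ∈ gtSet k u)
    (hl : l ∈ Lam (k + 1)) (huv : Interlaces u v) (hvl : Interlaces v l) :
    extendPattern k v l Z ∈ gtSet (k + 1) l := by
  have hv := huv.mem_Lam hvl hl
  have e1 : extendPattern k v l Z (2 * k + 1) = v := by simp [extendPattern]
  have e2 : extendPattern k v l Z (2 * k + 2) = l := by simp [extendPattern]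
  have e3 : ∀ j ≤ 2 * k, extendPattern k v l Z j = Z j := fun j hj => by simp [extendPattern, hj]
  refine ⟨fun j h1 h2 => ?_, fun j h1 h2 => ?_, ?_, fun j h1 => ?_, ?_⟩
  · rcases Nat.lt_or_ge (2 * k) j with h | h
    · obtain rfl | rfl : j = 2 * k + 1 ∨ j = 2 * k + 2 := by omega
      · rwa [e1, show (2 * k + 1 + 1) / 2 = k + 1 by omega]
      · rwa [e2, show (2 * k + 2 + 1) / 2 = k + 1 by omega]
    · rw [e3 j h]
      exact hZ.1 j h1 h
  · rcases Nat.lt_or_ge j (2 * k) with h | h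
    · rw [e3 j h.le, e3 (j + 1) h]
      exact hZ.2.1 j h1 h
    · obtain rfl | rfl : j = 2 * k ∨ j = 2 * k + 1 := by omega
      · rwa [e3 _ le_rfl, e1, hZ.2.2.2.2]
      · rwa [e1, e2]
  · rw [e3 0 (by omega), hZ.2.2.1]
  · simp [extendPattern, show ¬ j ≤ 2 * k by omega, show j ≠ 2 * k + 1 by omega,
      show j ≠ 2 * k + 2 by omega]
  · exact e2

theorem gtMonomial_succ {k : ℕ} (a : Fin (k + 1) → ℝ) (Z : ℕ → ℕ →₀ ℕ) :
    gtMonomial (k + 1) a Z = gtMonomial k (fun i => a i.castSucc) (truncPattern (2 * k) Z) *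
      a (Fin.last k) ^ stepExp (Z (2 * k + 2)) (Z (2 * k + 1)) (Z (2 * k)) := by
  unfold gtMonomial
  rw [Fin.prod_univ_castSucc]
  congr 1
  refine Finset.prod_congr rfl fun i _ => ?_
  have := i.2
  simp [truncPattern, show 2 * (i : ℕ) + 1 ≤ 2 * k by omega,
    show 2 * (i : ℕ) + 2 ≤ 2 * k by omega, show (i : ℕ) ≤ k by omega]

theorem kappa_succ {q : ℝ} (h0 : 0 < q) (h1 : q < 1) {k : ℕ} {l : ℕ →₀ ℕ} {Z : ℕ → ℕ →₀ ℕ}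
    (hZ : Z ∈ gtSet (k + 1) l) :
    kappa (k + 1) q Z = kappa k q (truncPattern (2 * k) Z) *
      stepWeight q (k + 1) (toSeq l) (toSeq (Z (2 * k + 1))) (toSeq (Z (2 * k))) := by
  have hl := hZ.2.2.2.2
  have hu := mem_Lam_of_mem_gtSet hZ (show 2 * k ≤ 2 * (k + 1) by omega)
  have hl' := mem_Lam_of_mem_gtSet hZ (show 2 * (k + 1) ≤ 2 * (k + 1) by omega)
  rw [show (2 * k + 1) / 2 = k by omega] at hu
  rw [show (2 * (k + 1) + 1) / 2 = k + 1 by omega] at hl'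
  have h2 := interlaces_of_mem_gtSet hZ (show 2 * k < 2 * (k + 1) by omega)
  have h3 := interlaces_of_mem_gtSet hZ (show 2 * k + 1 < 2 * (k + 1) by omega)
  rw [← hl, stepWeight_eq_prod_qBinom h0 h1 hl' hu h2 h3]
  unfold kappa
  rw [Finset.prod_range_succ]
  congr 1
  refine Finset.prod_congr rfl fun i hi => ?_
  have := Finset.mem_range.1 hi
  simp [truncPattern, show 2 * (i : ℕ) + 1 ≤ 2 * k by omega,
    show 2 * (i : ℕ) + 2 ≤ 2 * k by omega, show (i : ℕ) ≤ k by omega]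

theorem qSymp_eq_zero {n : ℕ} (a : Fin n → ℝ) (q : ℝ) {l : ℕ →₀ ℕ} (hl : l ∉ Lam n) :
    qSymp n a q l = 0 := by
  refine Finset.sum_eq_zero fun Z hZ => absurd ?_ hl
  have hZ := (gtSet_finite n l).mem_toFinset.1 hZ
  have := mem_Lam_of_mem_gtSet hZ le_rfl
  rwa [hZ.2.2.2.2, show (2 * n + 1) / 2 = n by omega] at this

/-- Grouping the patterns of shape `l` by their two levels below the top. -/
theorem qSymp_succ {q : ℝ} (h0 : 0 < q) (h1 : q < 1) {k : ℕ} (a : Fin (k + 1) → ℝ) {l : ℕ →₀ ℕ}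
    (hl : l ∈ Lam (k + 1)) {M : ℕ} (hM : l 0 ≤ M) :
    qSymp (k + 1) a q l = ∑ u ∈ box k M, ∑ v ∈ box (k + 1) M,
      a (Fin.last k) ^ stepExp l v u * stepWeight q (k + 1) (toSeq l) (toSeq v) (toSeq u) *
        qSymp k (fun i => a i.castSucc) q u := by
  rw [← Finset.sum_product']
  simp only [qSymp, Finset.mul_sum]
  rw [Finset.sum_sigma']
  refine Finset.sum_of_injOn
    (fun Z => ⟨(Z (2 * k), Z (2 * k + 1)), truncPattern (2 * k) Z⟩) ?_ ?_ ?_ ?_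
  · intro Z hZ Z' hZ' h
    simp only [Finset.mem_coe, Set.Finite.mem_toFinset] at hZ hZ'
    simp only [Sigma.mk.injEq, Prod.mk.injEq] at h
    obtain ⟨⟨-, hv⟩, ht⟩ := h
    have ht := eq_of_heq ht
    funext j
    rcases Nat.lt_or_ge (2 * k) j with h | h
    · rcases Nat.lt_or_ge (2 * (k + 1)) j with h' | h'
      · rw [hZ.2.2.2.1 j h', hZ'.2.2.2.1 j h']
      · obtain rfl | rfl : j = 2 * k + 1 ∨ j = 2 * (k + 1) := by omega
        · exact hv
        · rw [hZ.2.2.2.2, hZ'.2.2.2.2]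
    · simpa [truncPattern, h] using congrFun ht j
  · intro Z hZ
    simp only [Finset.mem_coe, Set.Finite.mem_toFinset] at hZ
    have hu := mem_Lam_of_mem_gtSet hZ (show 2 * k ≤ 2 * (k + 1) by omega)
    have hv := mem_Lam_of_mem_gtSet hZ (show 2 * k + 1 ≤ 2 * (k + 1) by omega)
    rw [show (2 * k + 1) / 2 = k by omega] at hu
    rw [show (2 * k + 1 + 1) / 2 = k + 1 by omega] at hv
    have g1 := le_of_mem_gtSet hZ (show 2 * k ≤ 2 * (k + 1) by omega) le_rfl 0
    have g2 := le_of_mem_gtSet hZ (show 2 * k + 1 ≤ 2 * (k + 1) by omega) le_rfl 0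
    rw [hZ.2.2.2.2] at g1 g2
    simp only [Finset.mem_coe, Finset.mem_sigma, Finset.mem_product, Set.Finite.mem_toFinset]
    exact ⟨⟨Lam.mem_box hu (g1.trans hM), Lam.mem_box hv (g2.trans hM)⟩,
      truncPattern_mem_gtSet hZ⟩
  · rintro ⟨⟨u, v⟩, W⟩ hp hnot
    simp only [Finset.mem_sigma, Finset.mem_product, Set.Finite.mem_toFinset] at hp
    obtain ⟨⟨hu, hv⟩, hW⟩ := hp
    by_contra hne
    have hw := right_ne_zero_of_mul (left_ne_zero_of_mul hne)
    have hint : Interlaces u v ∧ Interlaces v l := by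
      refine ⟨fun i => ?_, fun i => ?_⟩ <;> rcases Nat.lt_or_ge i (k + 1) with h | h
      · have := stepWeight_ne_zero hw h
        simp only [toSeq] at this
        omega
      · simp [(mem_box.1 hu).1 i (by omega), (mem_box.1 hv).1 (i + 1) (by omega)]
      · have := stepWeight_ne_zero hw h
        simp only [toSeq] at this
        omega
      · simp [(mem_box.1 hv).1 i h, Lam.eq_zero hl (show k + 1 ≤ i + 1 by omega)]
    refine hnot ⟨extendPattern k v l W, ?_, ?_⟩
    · simpa using extendPattern_mem_gtSet hW hl hint.1 hint.2
    · have hW2 := hW.2.2.2.2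
      have : truncPattern (2 * k) (extendPattern k v l W) = W := by
        funext j
        by_cases h : j ≤ 2 * k
        · simp [truncPattern, extendPattern, h]
        · simp [truncPattern, h, hW.2.2.2.1 j (by omega)]
      simp only [this]
      simp [extendPattern, hW2]
  · intro Z hZ
    simp only [Set.Finite.mem_toFinset] at hZ
    have hl2 : Z (2 * k + 2) = l := hZ.2.2.2.2
    rw [gtMonomial_succ, kappa_succ h0 h1 hZ, hl2]
    ring

theorem kernelSum_qSymp {q : ℝ} (h0 : 0 < q) (h1 : q < 1) {n : ℕ} (a : Fin n → ℝ)
    (ha : ∀ i, 0 < a i) {l : ℕ →₀ ℕ} (hl : l ∈ Lam n) :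
    kernelSum n q (qSymp n a q) l = (∑ i, (a i + (a i)⁻¹)) * qSymp n a q l := by
  induction n generalizing l with
  | zero => simp [kernelSum]
  | succ k ih =>
    rw [Fin.sum_univ_castSucc]
    exact kernelSum_succ h0 h1 (ha _).ne' (fun u hu => qSymp_eq_zero _ q hu)
      (fun l hl M hM => qSymp_succ h0 h1 a hl hM)
      (fun u hu => ih (fun i => a i.castSucc) (fun i => ha _) hu) hl

theorem gtSet_zero (n : ℕ) : gtSet n 0 = {0} := by
  ext Z
  refine ⟨fun hZ => ?_, ?_⟩
  · funext j
    rcases Nat.lt_or_ge (2 * n) j with h | h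
    · exact hZ.2.2.2.1 j h
    · ext i
      have := le_of_mem_gtSet hZ h le_rfl i
      rw [hZ.2.2.2.2] at this
      simpa using this
  · rintro rfl
    exact ⟨fun _ _ _ => mem_Lam_iff.2 ⟨antitone_const, fun _ _ => rfl⟩,
      fun _ _ _ _ => by simp, rfl, fun _ _ => rfl, rfl⟩

theorem qSymp_zero (q : ℝ) {n : ℕ} (a : Fin n → ℝ) : qSymp n a q 0 = 1 := by
  have : (gtSet_finite n 0).toFinset = {0} := by
    ext Z
    simp [gtSet_zero]
  rw [qSymp, this, Finset.sum_singleton]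
  simp [gtMonomial, kappa, qBinom, qFact, qPoch]

/-! ### Weighted oscillating tableaux -/

theorem differByBox_of_kernelL_ne_zero {n : ℕ} {q : ℝ} {l u : ℕ →₀ ℕ}
    (h : kernelL n q l u ≠ 0) : DifferByBox l u := by
  by_contra hne
  refine h (Finset.sum_eq_zero fun i _ => ?_)
  rw [if_neg fun h' => hne ⟨i, Or.inl h'⟩, if_neg fun h' => hne ⟨i, Or.inr h'⟩, add_zero]

theorem apply_zero_le_of_mem_oscSet {n m : ℕ} {l : ℕ →₀ ℕ} {f : Fin (m + 1) → ℕ →₀ ℕ}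
    (hf : f ∈ oscSet n m l) (i : Fin (m + 1)) : f i 0 ≤ i := by
  induction i using Fin.induction with
  | zero => simp [hf.1]
  | succ i ih =>
    obtain ⟨j, h | h⟩ := hf.2.1 i
    · rw [h]
      have : e j 0 ≤ 1 := by
        unfold e; rw [Finsupp.single_apply]; split_ifs <;> omega
      simp only [Finsupp.add_apply, Fin.val_succ, Fin.val_castSucc] at ih ⊢
      omega
    · rw [h] at ih
      simp only [Finsupp.add_apply, Fin.val_succ, Fin.val_castSucc] at ih ⊢
      omega

theorem oscSet_eq_empty {n m : ℕ} {l : ℕ →₀ ℕ} (h : m < l 0) : oscSet n m l = ∅ := by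
  refine Set.eq_empty_of_forall_notMem fun f hf => ?_
  have := apply_zero_le_of_mem_oscSet hf (Fin.last m)
  rw [hf.2.2.2] at this
  simp only [Fin.val_last] at this
  omega

theorem oscWeight_eq_zero {n m : ℕ} (q : ℝ) {l : ℕ →₀ ℕ} (h : m < l 0) :
    oscWeight n m q l = 0 := by
  have : (oscSet_finite n m l).toFinset = ∅ := by
    rw [Set.Finite.toFinset_eq_empty, oscSet_eq_empty h]
  rw [oscWeight, this, Finset.sum_empty]

theorem oscCount_eq_zero {n m : ℕ} {l : ℕ →₀ ℕ} (h : m < l 0) : oscCount n m l = 0 := by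
  rw [oscCount, Finset.card_eq_zero, Set.Finite.toFinset_eq_empty, oscSet_eq_empty h]

/-- The partitions in `Lam n` whose first part is at most `M`. -/
noncomputable def LamLE (n M : ℕ) : Finset (ℕ →₀ ℕ) := (Lam.finite_bounded n M).toFinset

theorem mem_LamLE {n M : ℕ} {l : ℕ →₀ ℕ} : l ∈ LamLE n M ↔ l ∈ Lam n ∧ l 0 ≤ M := by
  simp [LamLE]

/-- Splitting off the last step of an oscillating tableau. -/
theorem oscWeight_succ {n m M : ℕ} (q : ℝ) {u : ℕ →₀ ℕ} (hu : u ∈ Lam n) (hM : m ≤ M) :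
    oscWeight n (m + 1) q u = ∑ l ∈ LamLE n M, oscWeight n m q l * kernelL n q l u := by
  simp only [oscWeight, Finset.sum_mul]
  rw [Finset.sum_sigma']
  refine Finset.sum_of_injOn (fun f => ⟨f (Fin.last m).castSucc, Fin.init f⟩) ?_ ?_ ?_ ?_
  · intro f hf g hg h
    simp only [Finset.mem_coe, Set.Finite.mem_toFinset] at hf hg
    simp only [Sigma.mk.injEq] at h
    rw [← Fin.snoc_init_self f, ← Fin.snoc_init_self g, eq_of_heq h.2, hf.2.2.2, hg.2.2.2]
  · intro f hf
    simp only [Finset.mem_coe, Set.Finite.mem_toFinset] at hf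
    simp only [Finset.mem_coe, Finset.mem_sigma, Set.Finite.mem_toFinset, mem_LamLE]
    refine ⟨⟨hf.2.2.1 _, (apply_zero_le_of_mem_oscSet hf _).trans (by simpa using hM)⟩, ?_, ?_,
      fun i => hf.2.2.1 _, rfl⟩
    · exact hf.1
    · intro i
      exact hf.2.1 i.castSucc
  · rintro ⟨l, g⟩ hp hnot
    simp only [Finset.mem_sigma, Set.Finite.mem_toFinset, mem_LamLE] at hp
    obtain ⟨-, hg⟩ := hp
    by_contra hne
    have hd := differByBox_of_kernelL_ne_zero (right_ne_zero_of_mul hne)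
    refine hnot ⟨Fin.snoc (α := fun _ => ℕ →₀ ℕ) g u, ?_, ?_⟩
    · simp only [Finset.mem_coe, Set.Finite.mem_toFinset]
      refine ⟨?_, fun i => ?_, fun i => ?_, Fin.snoc_last _ _⟩
      · rw [← Fin.castSucc_zero, Fin.snoc_castSucc]
        exact hg.1
      · induction i using Fin.lastCases with
        | last =>
          rw [Fin.succ_last, Fin.snoc_last, Fin.snoc_castSucc, hg.2.2.2]
          exact hd
        | cast i =>
          rw [Fin.succ_castSucc, Fin.snoc_castSucc, Fin.snoc_castSucc]
          exact hg.2.1 i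
      · induction i using Fin.lastCases with
        | last => rwa [Fin.snoc_last]
        | cast i =>
          rw [Fin.snoc_castSucc]
          exact hg.2.2.1 i
    · simp only [Fin.init_snoc, Fin.snoc_castSucc, hg.2.2.2]
  · intro f hf
    simp only [Set.Finite.mem_toFinset] at hf
    rw [Fin.prod_univ_castSucc, Fin.succ_last, hf.2.2.2]
    rfl

theorem oscWeight_zero {n : ℕ} (q : ℝ) (l : ℕ →₀ ℕ) :
    oscWeight n 0 q l = if l = 0 then 1 else 0 := by
  have hs : oscSet n 0 l = if l = 0 then {fun _ => 0} else ∅ := by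
    ext f
    split_ifs with h
    · subst h
      constructor
      · intro hf
        funext i
        rw [Fin.fin_one_eq_zero i, hf.1]
      · rintro rfl
        exact ⟨rfl, fun i => i.elim0,
          fun _ => mem_Lam_iff.2 ⟨antitone_const, fun _ _ => rfl⟩, rfl⟩
    · refine iff_of_false (fun hf => h ?_) (Set.notMem_empty _)
      rw [← hf.2.2.2, ← hf.1]
      rfl
  split_ifs at hs ⊢ with h
  · have : (oscSet_finite n 0 l).toFinset = {fun _ => 0} := by
      ext f
      rw [Set.Finite.mem_toFinset, hs, Set.mem_singleton_iff, Finset.mem_singleton]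
    rw [oscWeight, this]
    simp
  · have : (oscSet_finite n 0 l).toFinset = ∅ := by
      rw [Set.Finite.toFinset_eq_empty, hs]
    rw [oscWeight, this, Finset.sum_empty]

theorem sum_kernelL_mul {n M : ℕ} {q : ℝ} {P : (ℕ →₀ ℕ) → ℝ} (hP : ∀ u, u ∉ Lam n → P u = 0)
    {l : ℕ →₀ ℕ} (hl : l 0 + 1 ≤ M) :
    ∑ u ∈ LamLE n M, kernelL n q l u * P u = kernelSum n q P l := by
  simp only [kernelL, kernelSum, Finset.sum_mul]
  rw [Finset.sum_comm]
  refine Finset.sum_congr rfl fun i _ => ?_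
  simp only [add_mul, Finset.sum_add_distrib]
  congr 1
  · rw [Finset.sum_eq_single (l + e i)]
    · simp
    · intro u _ hu
      simp [hu]
    · intro hmem
      have : e i 0 ≤ 1 := by unfold e; rw [Finsupp.single_apply]; split_ifs <;> omega
      rw [hP (l + e i), mul_zero]
      intro h
      refine hmem (mem_LamLE.2 ⟨h, ?_⟩)
      simp only [Finsupp.add_apply]
      omega
  · rw [Finset.sum_eq_single (l - e i)]
    · split_ifs with h1 h2 h2
      · rfl
      · exfalso
        have := DFunLike.congr_fun h1 i
        simp only [Finsupp.add_apply, e_self] at this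
        omega
      · exact absurd (sub_e_add_e h2).symm h1
      · rw [zero_mul]
    · intro u _ hu
      rw [if_neg, zero_mul]
      rintro rfl
      exact hu (add_tsub_cancel_right _ _).symm
    · intro hmem
      rw [hP (l - e i), mul_zero]
      intro h
      refine hmem (mem_LamLE.2 ⟨h, ?_⟩)
      simp only [Finsupp.tsub_apply]
      omega

theorem sum_oscWeight_mul_qSymp {q : ℝ} (h0 : 0 < q) (h1 : q < 1) {n : ℕ} (a : Fin n → ℝ)
    (ha : ∀ i, 0 < a i) {m M : ℕ} (hM : m ≤ M) :
    ∑ l ∈ LamLE n M, oscWeight n m q l * qSymp n a q l = (∑ i, (a i + (a i)⁻¹)) ^ m := by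
  induction m generalizing M with
  | zero =>
    simp only [oscWeight_zero, ite_mul, one_mul, zero_mul, pow_zero]
    rw [Finset.sum_ite_eq', if_pos, qSymp_zero]
    exact mem_LamLE.2 ⟨mem_Lam_iff.2 ⟨antitone_const, fun _ _ => rfl⟩, by simp⟩
  | succ m ih =>
    rw [pow_succ, ← ih le_rfl, Finset.sum_mul]
    have : ∀ u ∈ LamLE n M, oscWeight n (m + 1) q u * qSymp n a q u
        = ∑ l ∈ LamLE n m, oscWeight n m q l * (kernelL n q l u * qSymp n a q u) := by
      intro u hu
      rw [oscWeight_succ q (mem_LamLE.1 hu).1 le_rfl, Finset.sum_mul]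
      exact Finset.sum_congr rfl fun _ _ => mul_assoc _ _ _
    rw [Finset.sum_congr rfl this, Finset.sum_comm]
    refine Finset.sum_congr rfl fun l hl => ?_
    obtain ⟨hl, hlm⟩ := mem_LamLE.1 hl
    rw [← Finset.mul_sum, sum_kernelL_mul (fun u hu => qSymp_eq_zero a q hu) (by omega),
      kernelSum_qSymp h0 h1 a ha hl]
    ring

/-! ### The limit `q → 0` -/

theorem tendsto_one_sub_pow {N : ℕ} (hN : N ≠ 0) :
    Tendsto (fun q : ℝ => 1 - q ^ N) (𝓝[>] 0) (𝓝 1) := by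
  have : Tendsto (fun q : ℝ => 1 - q ^ N) (𝓝 0) (𝓝 (1 - 0 ^ N)) :=
    Continuous.tendsto (by fun_prop) 0
  rw [zero_pow hN, sub_zero] at this
  exact this.mono_left nhdsWithin_le_nhds

theorem tendsto_prod_one {ι : Type*} (s : Finset ι) {f : ι → ℝ → ℝ}
    (h : ∀ i ∈ s, Tendsto (f i) (𝓝[>] 0) (𝓝 1)) :
    Tendsto (fun q => ∏ i ∈ s, f i q) (𝓝[>] 0) (𝓝 1) := by
  simpa using tendsto_finsetProd s h

theorem tendsto_qPoch (N : ℕ) : Tendsto (fun q : ℝ => qPoch q N) (𝓝[>] 0) (𝓝 1) :=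
  tendsto_prod_one _ fun k hk => tendsto_one_sub_pow (by
    have := (Finset.mem_Icc.1 hk).1
    omega)

theorem tendsto_qFact (N : ℕ) : Tendsto (fun q : ℝ => qFact q N) (𝓝[>] 0) (𝓝 1) := by
  have h := (tendsto_one_sub_pow one_ne_zero).pow N
  simp only [pow_one, one_pow] at h
  have h2 := (tendsto_qPoch N).div h one_ne_zero
  rwa [div_one] at h2

theorem tendsto_qBinom (N k : ℕ) : Tendsto (fun q : ℝ => qBinom q N k) (𝓝[>] 0) (𝓝 1) := by
  have h := (tendsto_qFact N).div ((tendsto_qFact k).mul (tendsto_qFact (N - k))) (by simp)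
  rwa [mul_one, div_one] at h

theorem tendsto_kappa (n : ℕ) (Z : ℕ → ℕ →₀ ℕ) :
    Tendsto (fun q : ℝ => kappa n q Z) (𝓝[>] 0) (𝓝 1) := by
  refine tendsto_prod_one _ fun k _ => ?_
  rw [← mul_one (1 : ℝ)]
  refine Tendsto.mul (tendsto_prod_one _ fun i _ => ?_) (tendsto_qBinom _ _)
  rw [← mul_one (1 : ℝ)]
  exact (tendsto_qBinom _ _).mul (tendsto_qBinom _ _)

theorem tendsto_qSymp (n : ℕ) (a : Fin n → ℝ) (l : ℕ →₀ ℕ) :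
    Tendsto (fun q : ℝ => qSymp n a q l) (𝓝[>] 0)
      (𝓝 (∑ Z ∈ (gtSet_finite n l).toFinset, gtMonomial n a Z)) := by
  refine tendsto_finsetSum _ fun Z _ => ?_
  simpa using (tendsto_kappa n Z).const_mul (gtMonomial n a Z)

theorem tendsto_uPlus {n i : ℕ} {l : ℕ →₀ ℕ} (hu : l + e i ∈ Lam n) :
    Tendsto (fun q : ℝ => uPlus q l i) (𝓝[>] 0) (𝓝 1) := by
  unfold uPlus
  split_ifs with h
  · exact tendsto_const_nhds
  · refine tendsto_one_sub_pow ?_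
    have := hu.1 (show i - 1 ≤ i by omega)
    simp only [Finsupp.add_apply, e_self, e_of_ne (show i - 1 ≠ i by omega)] at this
    omega

theorem tendsto_uMinus {n i : ℕ} {u : ℕ →₀ ℕ} (hu : u ∈ Lam n) :
    Tendsto (fun q : ℝ => uMinus n q (u + e i) i) (𝓝[>] 0) (𝓝 1) := by
  unfold uMinus
  have := hu.1 (Nat.le_succ i)
  simp only [Nat.succ_eq_add_one] at this
  split_ifs with h <;> refine tendsto_one_sub_pow ?_ <;>
    simp only [Finsupp.add_apply, e_self, e_of_ne (show i + 1 ≠ i by omega)] <;> omega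

theorem e_injective {i j : ℕ} (h : e i = e j) : i = j := by
  by_contra hne
  have := DFunLike.congr_fun h i
  rw [e_self, e_of_ne hne] at this
  exact one_ne_zero this

theorem lt_of_add_e_mem_Lam {n i : ℕ} {l : ℕ →₀ ℕ} (h : l + e i ∈ Lam n) : i < n := by
  by_contra h'
  have := Lam.eq_zero h (not_lt.1 h')
  simp [e_self] at this

/-- Each allowed step of an oscillating tableau has weight tending to `1` as `q → 0`. -/
theorem tendsto_kernelL {n : ℕ} {l u : ℕ →₀ ℕ} (hl : l ∈ Lam n) (hu : u ∈ Lam n)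
    (h : DifferByBox l u) : Tendsto (fun q : ℝ => kernelL n q l u) (𝓝[>] 0) (𝓝 1) := by
  obtain ⟨j, rfl | rfl⟩ := h
  · have hj := lt_of_add_e_mem_Lam hu
    refine (tendsto_uPlus hu).congr fun q => ?_
    rw [kernelL, Finset.sum_eq_single_of_mem j (Finset.mem_range.2 hj)]
    · rw [if_pos rfl, if_neg, add_zero]
      intro h
      have := congrArg Finsupp.degree h
      simp only [map_add, degree_e] at this
      omega
    · intro i _ hij
      rw [if_neg fun h => hij (e_injective (add_left_cancel h)).symm, if_neg, add_zero]
      intro h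
      have := congrArg Finsupp.degree h
      simp only [map_add, degree_e] at this
      omega
  · have hj := lt_of_add_e_mem_Lam hl
    refine (tendsto_uMinus (i := j) hu).congr fun q => ?_
    rw [kernelL, Finset.sum_eq_single_of_mem j (Finset.mem_range.2 hj)]
    · rw [if_pos rfl, if_neg, zero_add]
      intro h
      have := congrArg Finsupp.degree h
      simp only [map_add, degree_e] at this
      omega
    · intro i _ hij
      rw [if_neg (c := u + e j = u + e i) fun h => hij (e_injective (add_left_cancel h)).symm,
        if_neg, add_zero]
      intro h
      have := congrArg Finsupp.degree h
      simp only [map_add, degree_e] at this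
      omega

theorem tendsto_oscWeight (n m : ℕ) (l : ℕ →₀ ℕ) :
    Tendsto (fun q : ℝ => oscWeight n m q l) (𝓝[>] 0) (𝓝 (oscCount n m l : ℝ)) := by
  have : (oscCount n m l : ℝ) = ∑ f ∈ (oscSet_finite n m l).toFinset, ∏ _i : Fin m, (1 : ℝ) := by
    simp [oscCount]
  rw [this]
  refine tendsto_finsetSum _ fun f hf => tendsto_finsetProd _ fun i _ => ?_
  have hf := (oscSet_finite n m l).mem_toFinset.1 hf
  exact tendsto_kernelL (hf.2.2.1 _) (hf.2.2.1 _) (hf.2.1 i)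

/-- A sum over `Lam n` whose terms vanish at partitions with a long first row. -/
theorem hasSum_Lam {n M : ℕ} (F : (ℕ →₀ ℕ) → ℝ) (hF : ∀ l, M < l 0 → F l = 0) :
    HasSum (fun l : Lam n => F l) (∑ l ∈ LamLE n M, F l) := by
  classical
  have hs : ∑ l ∈ LamLE n M, F l = ∑ l ∈ (LamLE n M).subtype (· ∈ Lam n), F l :=
    (Finset.sum_subtype_of_mem F fun l hl => (mem_LamLE.1 hl).1).symm
  rw [hs]
  refine hasSum_sum_of_ne_finset_zero fun l hl => hF _ ?_
  by_contra h
  exact hl (Finset.mem_subtype.2 (mem_LamLE.2 ⟨l.2, not_lt.1 h⟩))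

/-! ### Gelfand-Tsetlin patterns and symplectic tableaux -/

/-- A set of numbers below `N` that is closed downwards is an initial segment. -/
theorem lt_card_filter_range {N : ℕ} {p : ℕ → Prop} [DecidablePred p]
    (hp : ∀ i j, i ≤ j → j < N → p j → p i) (j : ℕ) :
    j < ((Finset.range N).filter p).card ↔ j < N ∧ p j := by
  constructor
  · intro h
    by_contra hj
    refine absurd (Finset.card_le_card (t := Finset.range j) fun i hi => ?_)
      (by simpa using h)
    obtain ⟨hiN, hpi⟩ := Finset.mem_filter.1 hi
    rw [Finset.mem_range] at hiN ⊢
    by_contra hji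
    exact hj ⟨by omega, hp j i (by omega) hiN hpi⟩
  · rintro ⟨hj, hpj⟩
    have : Finset.range (j + 1) ⊆ (Finset.range N).filter p := by
      intro i hi
      rw [Finset.mem_range] at hi
      exact Finset.mem_filter.2 ⟨Finset.mem_range.2 (by omega), hp i j (by omega) hj hpj⟩
    simpa using Finset.card_le_card this

/-- The shape formed by the entries smaller than `k` of a tableau. -/
noncomputable def subShape {n : ℕ} {l : Lam n} (T : SemistandardYoungTableau (diagram l))
    (k : ℕ) : ℕ →₀ ℕ :=
  Finsupp.onFinset l.1.support (fun i => ((Finset.range (l.1 i)).filter fun j => T i j < k).card)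
    fun i hi => by
      rw [Finsupp.mem_support_iff]
      intro h
      simp [h] at hi

theorem lt_subShape {n : ℕ} {l : Lam n} (T : SemistandardYoungTableau (diagram l))
    {k i j : ℕ} : j < subShape T k i ↔ j < l.1 i ∧ T i j < k := by
  rw [subShape, Finsupp.onFinset_apply]
  exact lt_card_filter_range (fun j1 j2 h h2 hT =>
    (T.row_weak_of_le h ((mem_diagram l i j2).2 h2)).trans_lt hT) j

theorem degree_subShape {n : ℕ} {l : Lam n} (T : SemistandardYoungTableau (diagram l)) (k : ℕ) :
    (subShape T k).degree = ((diagram l).cells.filter fun c => T c.1 c.2 < k).card := by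
  rw [Finset.card_eq_sum_card_fiberwise (f := Prod.fst) (t := l.1.support), Finsupp.degree_apply]
  · have hsub : (subShape T k).support ⊆ l.1.support := Finsupp.support_onFinset_subset
    rw [Finset.sum_subset hsub fun i _ hi => Finsupp.notMem_support_iff.1 hi]
    refine Finset.sum_congr rfl fun i _ => ?_
    rw [subShape, Finsupp.onFinset_apply]
    refine Finset.card_bij (fun j _ => (i, j)) (fun j hj => ?_) (fun _ _ _ _ h => ?_)
      (fun c hc => ?_)
    · obtain ⟨h1, h2⟩ := Finset.mem_filter.1 hj
      simp only [Finset.mem_filter, YoungDiagram.mem_cells, and_true]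
      exact ⟨(mem_diagram l i j).2 (Finset.mem_range.1 h1), h2⟩
    · exact (Prod.mk.inj h).2
    · obtain ⟨i', j⟩ := c
      simp only [Finset.mem_filter, YoungDiagram.mem_cells] at hc
      obtain ⟨⟨h1, h2⟩, rfl⟩ := hc
      exact ⟨j, Finset.mem_filter.2 ⟨Finset.mem_range.2 ((mem_diagram l i' j).1 h1), h2⟩, rfl⟩
  · intro c hc
    have hc := (mem_diagram l c.1 c.2).1 ((YoungDiagram.mem_cells _).1 (Finset.mem_filter.1 hc).1)
    simp only [Finset.mem_coe, Finsupp.mem_support_iff]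
    omega

theorem card_filter_eq {n : ℕ} {l : Lam n} (T : SemistandardYoungTableau (diagram l)) (k : ℕ) :
    (((diagram l).cells.filter fun c => T c.1 c.2 = k).card : ℤ)
      = (subShape T (k + 1)).degree - (subShape T k).degree := by
  rw [degree_subShape, degree_subShape, eq_sub_iff_add_eq]
  norm_cast
  rw [← Finset.card_union_of_disjoint, ← Finset.filter_or]
  · congr 1
    refine Finset.filter_congr fun c _ => ?_
    omega
  · exact Finset.disjoint_filter.2 fun c _ h1 h2 => by omega

/-- The Gelfand-Tsetlin pattern of a tableau. -/
noncomputable def tableauPattern {n : ℕ} {l : Lam n} (T : SemistandardYoungTableau (diagram l)) :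
    ℕ → ℕ →₀ ℕ :=
  truncPattern (2 * n) (subShape T)

theorem tableauMonomial_eq {n : ℕ} (a : Fin n → ℝ) {l : Lam n}
    (T : SemistandardYoungTableau (diagram l)) :
    tableauMonomial a T = gtMonomial n a (tableauPattern T) := by
  refine Finset.prod_congr rfl fun k _ => ?_
  have := k.2
  rw [card_filter_eq, card_filter_eq]
  simp only [tableauPattern, truncPattern, if_pos (show 2 * (k : ℕ) + 1 ≤ 2 * n by omega),
    if_pos (show 2 * (k : ℕ) + 2 ≤ 2 * n by omega), if_pos (show 2 * (k : ℕ) ≤ 2 * n by omega)]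
  congr 1
  ring

theorem tableauPattern_mem_gtSet {n : ℕ} {l : Lam n} {T : SemistandardYoungTableau (diagram l)}
    (hT : T ∈ tableauSet n l) : tableauPattern T ∈ gtSet n l := by
  have hcol : ∀ k i j, j < subShape T (k + 1) (i + 1) → j < subShape T k i := by
    intro k i j h
    rw [lt_subShape] at h ⊢
    have := T.col_strict (show i < i + 1 by omega) ((mem_diagram l (i + 1) j).2 h.1)
    have := l.2.1 (Nat.le_succ i)
    simp only [Nat.succ_eq_add_one] at this
    omega
  have hmono : ∀ k i j, j < subShape T k i → j < subShape T (k + 1) i := by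
    intro k i j h
    rw [lt_subShape] at h ⊢
    omega
  refine ⟨fun k h1 h2 => ?_, fun k h1 h2 => ?_, ?_, fun k h1 => ?_, ?_⟩
  · rw [tableauPattern, truncPattern, if_pos h2, mem_Lam_iff]
    refine ⟨antitone_nat_of_succ_le fun i => le_of_forall_lt fun j hj =>
      hcol _ _ _ (hmono _ _ _ hj), fun i hi => ?_⟩
    by_contra hne
    obtain ⟨h3, h4⟩ := (lt_subShape T).1 (Nat.pos_of_ne_zero hne)
    have := (hT i 0 ((mem_diagram l i 0).2 h3)).2
    omega
  · rw [tableauPattern, truncPattern, if_pos h2.le, truncPattern, if_pos (by omega)]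
    exact fun i => ⟨le_of_forall_lt (hmono k i), le_of_forall_lt (hcol k i)⟩
  · rw [tableauPattern, truncPattern, if_pos (by omega)]
    ext i
    refine Nat.le_zero.1 (le_of_forall_lt fun j hj => ?_)
    rw [lt_subShape] at hj
    omega
  · rw [tableauPattern, truncPattern, if_neg (by omega)]
  · rw [tableauPattern, truncPattern, if_pos le_rfl]
    ext i
    refine eq_of_forall_lt_iff fun j => ?_
    rw [lt_subShape]
    exact and_iff_left_of_imp fun h => (hT i j ((mem_diagram l i j).2 h)).1

theorem tableauPattern_injOn (n : ℕ) (l : Lam n) :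
    Set.InjOn (tableauPattern (l := l)) (tableauSet n l) := by
  have key : ∀ T ∈ tableauSet n l, ∀ T' ∈ tableauSet n l, tableauPattern T = tableauPattern T' →
      ∀ i j, j < l.1 i → T i j ≤ T' i j := by
    intro T _ T' hT' h i j hj
    have hlt := (hT' i j ((mem_diagram l i j).2 hj)).1
    have h2 := congrFun h (T' i j + 1)
    rw [tableauPattern, tableauPattern, truncPattern, truncPattern,
      if_pos (show T' i j + 1 ≤ 2 * n from hlt), if_pos (show T' i j + 1 ≤ 2 * n from hlt)] at h2
    have h3 : j < subShape T' (T' i j + 1) i := (lt_subShape T').2 ⟨hj, Nat.lt_succ_self _⟩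
    rw [← h2, lt_subShape] at h3
    omega
  intro T hT T' hT' h
  ext i j
  by_cases hj : j < l.1 i
  · exact le_antisymm (key T hT T' hT' h i j hj) (key T' hT' T hT h.symm i j hj)
  · rw [← mem_diagram] at hj
    rw [T.zeros hj, T'.zeros hj]

/-- The entry in cell `(i, j)` of the tableau of a pattern: the number of levels whose row `i`
does not reach column `j`. -/
def patternEntry (n : ℕ) (Z : ℕ → ℕ →₀ ℕ) (i j : ℕ) : ℕ :=
  ((Finset.range (2 * n)).filter fun k => Z (k + 1) i ≤ j).card

theorem patternEntry_lt {n : ℕ} {l : ℕ →₀ ℕ} {Z : ℕ → ℕ →₀ ℕ} (hZ : Z ∈ gtSet n l) {i j k : ℕ}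
    (hk : k ≤ 2 * n) : patternEntry n Z i j < k ↔ j < Z k i := by
  rcases k with _ | k
  · simp [hZ.2.2.1]
  · have := lt_card_filter_range (N := 2 * n) (p := fun k => Z (k + 1) i ≤ j)
      (fun k1 k2 h h2 h3 => (le_of_mem_gtSet hZ (by omega) (by omega) i).trans h3) k
    rw [← not_iff_not, not_lt, not_lt, Nat.succ_le_iff]
    refine this.trans (and_iff_right ?_)
    omega

/-- The tableau of a Gelfand-Tsetlin pattern. -/
def patternTableau {n : ℕ} {l : Lam n} {Z : ℕ → ℕ →₀ ℕ} (hZ : Z ∈ gtSet n l) :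
    SemistandardYoungTableau (diagram l) where
  entry i j := if j < l.1 i then patternEntry n Z i j else 0
  row_weak' := by
    intro i j1 j2 hj hmem
    rw [mem_diagram] at hmem
    rw [if_pos hmem, if_pos (by omega)]
    exact Finset.card_le_card
      (Finset.monotone_filter_right _ fun k _ (hk : Z (k + 1) i ≤ j1) => hk.trans hj.le)
  col_strict' := by
    intro i1 i2 j hi hmem
    rw [mem_diagram] at hmem
    rw [if_pos hmem, if_pos (hmem.trans_le (l.2.1 hi.le))]
    have h1 : patternEntry n Z i2 j < 2 * n := by
      rw [patternEntry_lt hZ le_rfl, hZ.2.2.2.2]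
      exact hmem
    -- Row `i2` reaches column `j` at level `t + 1`, where `t` is the lower entry, so by
    -- interlacing row `i1` reaches it at level `t`.
    have h2 := (patternEntry_lt hZ (i := i2) (j := j) h1).1 (Nat.lt_succ_self _)
    rw [patternEntry_lt hZ h1.le]
    have h3 := (mem_Lam_of_mem_gtSet hZ (show patternEntry n Z i2 j + 1 ≤ 2 * n from h1)).1
      (show i1 + 1 ≤ i2 from hi)
    have h4 := (interlaces_of_mem_gtSet hZ h1 i1).2
    simp only [Nat.succ_eq_add_one] at h2
    omega
  zeros' := by
    intro i j h
    rw [mem_diagram] at h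
    rw [if_neg h]

theorem patternTableau_apply {n : ℕ} {l : Lam n} {Z : ℕ → ℕ →₀ ℕ} (hZ : Z ∈ gtSet n l)
    {i j : ℕ} (h : j < l.1 i) : patternTableau hZ i j = patternEntry n Z i j := if_pos h

theorem patternTableau_mem {n : ℕ} {l : Lam n} {Z : ℕ → ℕ →₀ ℕ} (hZ : Z ∈ gtSet n l) :
    patternTableau hZ ∈ tableauSet n l := by
  intro i j h
  rw [mem_diagram] at h
  rw [patternTableau_apply hZ h]
  refine ⟨by rwa [patternEntry_lt hZ le_rfl, hZ.2.2.2.2], ?_⟩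
  have hi : i < n := by
    by_contra h'
    rw [Lam.eq_zero l.2 (not_lt.1 h')] at h
    omega
  by_contra hlt
  rw [not_le, patternEntry_lt hZ (by omega)] at hlt
  have := Lam.eq_zero (mem_Lam_of_mem_gtSet hZ (show 2 * i ≤ 2 * n by omega))
    (show (2 * i + 1) / 2 ≤ i by omega)
  omega

theorem tableauPattern_patternTableau {n : ℕ} {l : Lam n} {Z : ℕ → ℕ →₀ ℕ}
    (hZ : Z ∈ gtSet n l) : tableauPattern (patternTableau hZ) = Z := by
  funext k
  rcases Nat.lt_or_ge (2 * n) k with hk | hk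
  · rw [tableauPattern, truncPattern, if_neg (by omega), hZ.2.2.2.1 k hk]
  · rw [tableauPattern, truncPattern, if_pos hk]
    ext i
    refine eq_of_forall_lt_iff fun j => ?_
    have hle := le_of_mem_gtSet hZ hk le_rfl i
    rw [hZ.2.2.2.2] at hle
    rw [lt_subShape, ← patternEntry_lt hZ hk]
    refine ⟨fun h => by rw [← patternTableau_apply hZ h.1]; exact h.2, fun h => ?_⟩
    have hj : j < l.1 i := ((patternEntry_lt hZ hk).1 h).trans_le hle
    exact ⟨hj, by rwa [patternTableau_apply hZ hj]⟩

theorem sympSchur_eq_sum_gtMonomial (n : ℕ) (a : Fin n → ℝ) (l : Lam n) :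
    sympSchur n a l = ∑ Z ∈ (gtSet_finite n l).toFinset, gtMonomial n a Z := by
  refine Finset.sum_bij (fun T _ => tableauPattern T) (fun T hT => ?_) (fun T hT T' hT' h => ?_)
    (fun Z hZ => ?_) fun T _ => tableauMonomial_eq a T
  · rw [Set.Finite.mem_toFinset] at hT ⊢
    exact tableauPattern_mem_gtSet hT
  · rw [Set.Finite.mem_toFinset] at hT hT'
    exact tableauPattern_injOn n l hT hT' h
  · rw [Set.Finite.mem_toFinset] at hZ
    exact ⟨patternTableau hZ, (tableauSet_finite n l).mem_toFinset.2 (patternTableau_mem hZ),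
      tableauPattern_patternTableau hZ⟩

end QBerele

/-! ### The expansion -/

theorem corollary6p4 (n : ℕ) (hn : 1 ≤ n) (m : ℕ) (a : Fin n → ℝ) (ha : ∀ i, 0 < a i) :
    (∀ q : ℝ, 0 < q → q < 1 →
      HasSum (fun l : QBerele.Lam n => QBerele.oscWeight n m q l * QBerele.qSymp n a q l)
        ((∑ i, (a i + (a i)⁻¹)) ^ m)) ∧
    (∀ l : QBerele.Lam n,
      Tendsto (fun q : ℝ => QBerele.oscWeight n m q l) (𝓝[>] 0)
        (𝓝 (QBerele.oscCount n m l : ℝ))) ∧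
    (∀ l : QBerele.Lam n,
      Tendsto (fun q : ℝ => QBerele.qSymp n a q l) (𝓝[>] 0) (𝓝 (QBerele.sympSchur n a l))) ∧
    HasSum (fun l : QBerele.Lam n => (QBerele.oscCount n m l : ℝ) * QBerele.sympSchur n a l)
      ((∑ i, (a i + (a i)⁻¹)) ^ m) := by
  have hlim : ∀ l, Tendsto (fun q : ℝ => QBerele.qSymp n a q l) (𝓝[>] 0)
      (𝓝 (∑ Z ∈ (QBerele.gtSet_finite n l).toFinset, QBerele.gtMonomial n a Z)) :=
    QBerele.tendsto_qSymp n a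
  refine ⟨fun q h0 h1 => ?_, fun l => QBerele.tendsto_oscWeight n m l, fun l => ?_, ?_⟩
  · rw [← QBerele.sum_oscWeight_mul_qSymp h0 h1 a ha (le_refl m)]
    exact QBerele.hasSum_Lam (fun l => QBerele.oscWeight n m q l * QBerele.qSymp n a q l)
      fun l hl => by rw [QBerele.oscWeight_eq_zero q hl, zero_mul]
  · rw [QBerele.sympSchur_eq_sum_gtMonomial]
    exact hlim l
  · simp only [QBerele.sympSchur_eq_sum_gtMonomial]
    -- The number of terms is bounded uniformly in `q`, so the identity passes to the limit.
    have h1 : Tendsto (fun q : ℝ => ∑ l ∈ QBerele.LamLE n m,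
        QBerele.oscWeight n m q l * QBerele.qSymp n a q l) (𝓝[>] 0) _ :=
      tendsto_finsetSum _ fun l _ => (QBerele.tendsto_oscWeight n m l).mul (hlim l)
    have h2 : Tendsto (fun q : ℝ => ∑ l ∈ QBerele.LamLE n m,
        QBerele.oscWeight n m q l * QBerele.qSymp n a q l) (𝓝[>] 0)
        (𝓝 ((∑ i, (a i + (a i)⁻¹)) ^ m)) := by
      refine tendsto_const_nhds.congr' ?_
      filter_upwards [Ioo_mem_nhdsGT one_pos] with q hq
      exact (QBerele.sum_oscWeight_mul_qSymp hq.1 hq.2 a ha le_rfl).symm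
    rw [tendsto_nhds_unique h2 h1]
    exact QBerele.hasSum_Lam (fun l => (QBerele.oscCount n m l : ℝ) *
        ∑ Z ∈ (QBerele.gtSet_finite n l).toFinset, QBerele.gtMonomial n a Z)
      fun l hl => by rw [QBerele.oscCount_eq_zero hl, Nat.cast_zero, zero_mul]
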